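/- **Setting.** For each $n\ge 1$ let $Y_1,\dots,Y_n$ be i.i.d. random vectors in $\mathbb R^{p_n}$ ($p_n\ge 1$) with mean zero and covariance matrix $\Sigma_{0}=\Sigma_{0n}$, under a probability measure $\mathbb P_{0}=\mathbb P_{0n}$. Assume: 1. there are constants $k_\sigma\in(0,1]$ and $\sigma_0>0$, not depending on $n$, such that all eigenvalues of $\Sigma_{0}$ lie in $[k_\sigma,1/k_\sigma]$ and $\|\Sigma_0^{-1/2}Y_1\|_{\psi_2}\le\sigma_0$, where $\|X\|_{\psi_2}=\sup_{\|u\|=1}\sup_{q\ge1}q^{-1/2}(E|u^TX|^q)^{1/q}$; 2. $p_n^5=o(n)$. Let $S=\frac1n\sum_{i=1}^nY_iY_i^T$ and $\Omega_0=\Sigma_0^{-1}$; $\|\cdot\|$ is the spectral norm, $\mathbb P_p^+$ the set of positive definite symmetric $p\times p$ matrices and $M_p$ the space of symmetric $p\times p$ matrices, with $dT=\prod_{j\le i}dT_{ij}$. In the working model $Y_1,\dots,Y_n$ are i.i.d. $N_{p}(0,\Omega^{-1})$, with log-likelihood $l_n(\Omega)=-\frac{np}2\log(2\pi)+\frac n2\log\det\Omega-\frac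 n2\mathrm{tr}(\Omega S)$, and $\Omega$ has a prior distribution on $\mathbb P_{p}^+$ with density $\pi_n$ ($p=p_n$). With $B_n=\{T\in M_p: S^{-1}+T/\sqrt n\in\mathbb P_p^+\}$ and $M_n(T)=\exp\{l_n(S^{-1}+T/\sqrt n)-l_n(S^{-1})\}$, the posterior density of $T=\sqrt n(\Omega-S^{-1})$ is $$\pi_n(T\mid Y^n)=\frac{M_n(T)\,\pi_n(S^{-1}+T/\sqrt n)}{\int_{B_n}M_n(W)\,\pi_n(S^{-1}+W/\sqrt n)\,dW}\quad(T\in B_n),$$ and $0$ for $T\notin B_n$. Assume further: 3. (*flatness*) for every constant $M>0$, $$\sup\left\{\left|\frac{\pi_n(S^{-1}+T/\sqrt n)}{\pi_n(S^{-1})}-1\right| : T\in B_n,\ \|T\|\le M\sqrt{p_n}\right\}\to0\quad\text{in }\mathbb P_0\text{-probability};$$ 4. (*contraction rate $\sqrt{p_n/n}$*) for every sequence $M_n\to\infty$, the posterior probability of $\{\|\Omega-\Omega_0\|>M_n\sqrt{p_n/n}\}$ tends to $0$ in $\mathbb P_0$-probability. **Theorem (BvM theorem for a precision matrix).** Under these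 assumptions $$\int_{M_{p}}\left|\pi_n(T\mid Y^n)-\phi(T;S)\right|dT\ \longrightarrow\ 0\quad\text{in }\mathbb P_0\text{-probability as }n\to\infty,$$ where $\phi(\cdot;S)$ is the density of the symmetric matrix-normal law $\mathcal{SMN}_{p\times p}(0,\,2B_p^T(S^{-1}\otimes S^{-1})B_p)$, i.e. the law of the symmetric random matrix $X$ with $\mathrm{vech}(X)\sim N_{p(p+1)/2}(0,\,2B_p^T(S^{-1}\otimes S^{-1})B_p)$. Here $\mathrm{vec}$ stacks columns, $\mathrm{vech}$ lists the entries on and below the diagonal, and $B_p$ is the $p^2\times\frac{p(p+1)}2$ matrix whose column belonging to the entry $(i,j)$, $j\le i$, is $\frac12(e_j\otimes e_i+e_i\otimes e_j)$, so that $\mathrm{vech}(A)=B_p^T\mathrm{vec}(A)$ for symmetric $A$. Equivalently, $\phi(T;S)\propto\exp\{-\mathrm{tr}(STST)/4\}$. -/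

import Mathlib

open MeasureTheory ProbabilityTheory Filter Matrix
open scoped Topology ENNReal Kronecker Asymptotics

noncomputable section

namespace BvM

/-- Positions on or below the diagonal of a `p × p` matrix: the index set of `vech`. -/
abbrev VechIdx (p : ℕ) : Type := {ij : Fin p × Fin p // ij.2 ≤ ij.1}

/-- Half-vectorization: the entries on and below the diagonal. -/
def vech {p : ℕ} (A : Matrix (Fin p) (Fin p) ℝ) : VechIdx p → ℝ :=
  fun ij => A ij.1.1 ij.1.2

/-- The symmetric matrix with given entries on and below the diagonal. Integration over symmetric
matrices is integration against Lebesgue measure in these `p (p + 1) / 2` coordinates. -/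
def symMat {p : ℕ} (t : VechIdx p → ℝ) : Matrix (Fin p) (Fin p) ℝ :=
  Matrix.of fun i j =>
    if h : j ≤ i then t ⟨(i, j), h⟩ else t ⟨(j, i), le_of_lt (not_le.mp h)⟩

/-- The (symmetrized) elimination matrix `B_p`, of size `p² × p (p + 1) / 2`: the column with
index `(i, j)`, `j ≤ i`, is `(e_j ⊗ e_i + e_i ⊗ e_j) / 2`. Rows are indexed as in
`Matrix.vec`, which stacks columns. -/
def elimMat (p : ℕ) : Matrix (Fin p × Fin p) (VechIdx p) ℝ :=
  Matrix.of fun ab ij =>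
    ((if ab = (ij.1.2, ij.1.1) then 1 else 0) + (if ab = (ij.1.1, ij.1.2) then 1 else 0)) / 2

/-- `B_pᵀ vec A = vech A` for symmetric `A`. -/
theorem elimMat_transpose_mulVec_vec {p : ℕ} (A : Matrix (Fin p) (Fin p) ℝ) (hA : A.IsSymm) :
    (elimMat p)ᵀ *ᵥ A.vec = vech A := by
  ext ij
  have h : A ij.1.2 ij.1.1 = A ij.1.1 ij.1.2 := hA.apply _ _
  simp only [Matrix.mulVec, dotProduct, Matrix.transpose_apply, elimMat, Matrix.of_apply,
    Matrix.vec, vech, add_div, add_mul, Finset.sum_add_distrib, ite_div, zero_div, ite_mul,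
    zero_mul, Finset.sum_ite_eq', Finset.mem_univ, if_true, h]
  ring

/-- Density (in `vech` coordinates) of the symmetric matrix-normal distribution with mean `M` and
parameter `C`: the density at `vech X` of the normal law with mean `vech M` and covariance `C`. -/
def smnDensity {p : ℕ} (M : Matrix (Fin p) (Fin p) ℝ) (C : Matrix (VechIdx p) (VechIdx p) ℝ)
    (X : Matrix (Fin p) (Fin p) ℝ) : ℝ :=
  Real.exp (-((vech X - vech M) ⬝ᵥ (C⁻¹ *ᵥ (vech X - vech M))) / 2) /
    √((2 * Real.pi) ^ Fintype.card (VechIdx p) * C.det)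

/-- The parameter `2 B_pᵀ (S⁻¹ ⊗ S⁻¹) B_p`. -/
def limitCov {p : ℕ} (S : Matrix (Fin p) (Fin p) ℝ) : Matrix (VechIdx p) (VechIdx p) ℝ :=
  (2 : ℝ) • ((elimMat p)ᵀ * (S⁻¹ ⊗ₖ S⁻¹) * elimMat p)

/-- Spectral norm. -/
def opNorm {p : ℕ} (A : Matrix (Fin p) (Fin p) ℝ) : ℝ :=
  ‖Matrix.toEuclideanCLM (𝕜 := ℝ) A‖

/-- Symmetric, with all eigenvalues in `[k, 1 / k]`. -/
def WellConditioned {p : ℕ} (k : ℝ) (A : Matrix (Fin p) (Fin p) ℝ) : Prop :=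
  ∃ h : A.IsHermitian, ∀ i, k ≤ h.eigenvalues i ∧ h.eigenvalues i ≤ 1 / k

/-- `A ^ (-1/2)` for a symmetric positive definite `A`. -/
def invSqrt {p : ℕ} (A : Matrix (Fin p) (Fin p) ℝ) : Matrix (Fin p) (Fin p) ℝ :=
  cfc (fun x : ℝ => (√x)⁻¹) A

/-- Sub-Gaussian norm `sup_{q ≥ 1} q ^ (-1/2) (E |X| ^ q) ^ (1/q)` of a random variable. -/
def subGaussianNorm {𝓧 : Type*} [MeasurableSpace 𝓧] (P : Measure 𝓧) (X : 𝓧 → ℝ) : ℝ≥0∞ :=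
  ⨆ (q : ℝ) (_ : 1 ≤ q), ENNReal.ofReal (√q)⁻¹ * eLpNorm X (ENNReal.ofReal q) P

/-- Sub-Gaussian norm of a random vector: supremum over the directions in the unit sphere. -/
def subGaussianNormVec {𝓧 : Type*} [MeasurableSpace 𝓧] (P : Measure 𝓧) {p : ℕ}
    (X : 𝓧 → Fin p → ℝ) : ℝ≥0∞ :=
  ⨆ (u : EuclideanSpace ℝ (Fin p)) (_ : ‖u‖ = 1), subGaussianNorm P fun ω => u.ofLp ⬝ᵥ X ω

/-- The true data-generating mechanism at one sample size: an i.i.d. sample of mean zero random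
vectors with well-conditioned covariance matrix `Σ₀`, sub-Gaussian after standardization. -/
structure IsTrueModel {𝓧 : Type*} [MeasurableSpace 𝓧] (P : Measure 𝓧) {n p : ℕ}
    (Y : Fin n → 𝓧 → Fin p → ℝ) (Sigma0 : Matrix (Fin p) (Fin p) ℝ) (k σ₀ : ℝ) : Prop where
  measurable : ∀ i, Measurable (Y i)
  indep : iIndepFun Y P
  identDistrib : ∀ i j, IdentDistrib (Y i) (Y j) P P
  mean_zero : ∀ i a, ∫ ω, Y i ω a ∂P = 0
  covariance : ∀ i a b, ∫ ω, Y i ω a * Y i ω b ∂P = Sigma0 a b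
  wellConditioned : WellConditioned k Sigma0
  subGaussian : ∀ i,
    subGaussianNormVec P (fun ω => invSqrt Sigma0 *ᵥ Y i ω) ≤ ENNReal.ofReal σ₀

/-- Sample covariance matrix `n⁻¹ ∑ Y_i Y_iᵀ`. -/
def sampleCov {n p : ℕ} (y : Fin n → Fin p → ℝ) : Matrix (Fin p) (Fin p) ℝ :=
  (n : ℝ)⁻¹ • ∑ i, Matrix.vecMulVec (y i) (y i)

/-- `π` is (on the positive definite matrices) the density of a probability distribution on the
positive definite `p × p` matrices. -/
structure IsPriorDensity {p : ℕ} (π : Matrix (Fin p) (Fin p) ℝ → ℝ) : Prop where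
  measurable : Measurable fun t : VechIdx p → ℝ => π (symMat t)
  nonneg : ∀ W, W.PosDef → 0 ≤ π W
  lintegral_eq_one : ∫⁻ t in {t : VechIdx p → ℝ | (symMat t).PosDef},
    ENNReal.ofReal (π (symMat t)) = 1

/-- Log-likelihood of the precision matrix `W` in the Gaussian working model
`N_p(0, W⁻¹)`, for a sample of size `n` with sample covariance `S`. -/
def logLik {p : ℕ} (n : ℕ) (S W : Matrix (Fin p) (Fin p) ℝ) : ℝ :=
  -(n * p / 2) * Real.log (2 * Real.pi) + n / 2 * Real.log W.det - n / 2 * (W * S).trace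

/-- `S⁻¹ + T / √n`, the precision matrix that corresponds to the local parameter `T`. -/
def precOf {p : ℕ} (n : ℕ) (S : Matrix (Fin p) (Fin p) ℝ) (t : VechIdx p → ℝ) :
    Matrix (Fin p) (Fin p) ℝ :=
  S⁻¹ + (√(n : ℝ))⁻¹ • symMat t

/-- Local parameters `T` for which `S⁻¹ + T / √n` is positive definite. -/
def localSet {p : ℕ} (n : ℕ) (S : Matrix (Fin p) (Fin p) ℝ) : Set (VechIdx p → ℝ) :=
  {t | (precOf n S t).PosDef}

/-- Likelihood ratio `exp (l (S⁻¹ + T / √n) - l (S⁻¹))`, set to zero outside `localSet`. -/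
def likRatio {p : ℕ} (n : ℕ) (S : Matrix (Fin p) (Fin p) ℝ) : (VechIdx p → ℝ) → ℝ :=
  (localSet n S).indicator fun t => Real.exp (logLik n S (precOf n S t) - logLik n S S⁻¹)

/-- Posterior density of `T = √n (Ω - S⁻¹)` under the prior density `π` for `Ω`. -/
def postDensity {p : ℕ} (n : ℕ) (π : Matrix (Fin p) (Fin p) ℝ → ℝ)
    (S : Matrix (Fin p) (Fin p) ℝ) (t : VechIdx p → ℝ) : ℝ :=
  likRatio n S t * π (precOf n S t) /
    ∫ w in localSet n S, likRatio n S w * π (precOf n S w)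

/-- Posterior probability that `Ω = S⁻¹ + T / √n` lies in `A`. -/
def postProb {p : ℕ} (n : ℕ) (π : Matrix (Fin p) (Fin p) ℝ → ℝ)
    (S : Matrix (Fin p) (Fin p) ℝ) (A : Set (Matrix (Fin p) (Fin p) ℝ)) : ℝ≥0∞ :=
  ∫⁻ t in {t | t ∈ localSet n S ∧ precOf n S t ∈ A}, ENNReal.ofReal (postDensity n π S t)

/-- `sup |π (S⁻¹ + T / √n) / π (S⁻¹) - 1|` over the `T` with `S⁻¹ + T / √n` positive definite
and `‖T‖ ≤ √n ε`. -/
def flatness {p : ℕ} (n : ℕ) (π : Matrix (Fin p) (Fin p) ℝ → ℝ)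
    (S : Matrix (Fin p) (Fin p) ℝ) (ε : ℝ) : ℝ≥0∞ :=
  ⨆ t ∈ {t | t ∈ localSet n S ∧ opNorm (symMat t) ≤ √(n : ℝ) * ε},
    ENNReal.ofReal |π (precOf n S t) / π S⁻¹ - 1|

/-- Convergence to zero in probability, along a sequence of probability spaces. -/
def TendstoZeroInProb {𝓧 : ℕ → Type*} [∀ n, MeasurableSpace (𝓧 n)] (P : ∀ n, Measure (𝓧 n))
    (X : ∀ n, 𝓧 n → ℝ≥0∞) : Prop :=
  ∀ δ : ℝ≥0∞, 0 < δ → Tendsto (fun n => P n {ω | δ ≤ X n ω}) atTop (𝓝 0)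

/-- The posterior of `Ω` contracts around `Ω₀` at the rate `√(p_n / n)`: for every `M_n → ∞`
the posterior probability of `‖Ω - Ω₀‖ > M_n √(p_n / n)` tends to zero in probability. -/
def PosteriorContracts {𝓧 : ℕ → Type*} [∀ n, MeasurableSpace (𝓧 n)] (P : ∀ n, Measure (𝓧 n))
    (p : ℕ → ℕ) (Y : ∀ n, Fin n → 𝓧 n → Fin (p n) → ℝ)
    (π : ∀ n, Matrix (Fin (p n)) (Fin (p n)) ℝ → ℝ)
    (Omega0 : ∀ n, Matrix (Fin (p n)) (Fin (p n)) ℝ) : Prop :=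
  ∀ M : ℕ → ℝ, Tendsto M atTop atTop →
    TendstoZeroInProb P fun n ω => postProb n (π n) (sampleCov fun i => Y n i ω)
      {W | M n * √((p n : ℝ) / n) < opNorm (W - Omega0 n)}

/-- The prior is flat around `S⁻¹` at the scale `√(p_n / n)`: for every constant `M > 0` the
relative oscillation of its density over `‖Ω - S⁻¹‖ ≤ M √(p_n / n)` tends to zero in
probability. -/
def PriorFlat {𝓧 : ℕ → Type*} [∀ n, MeasurableSpace (𝓧 n)] (P : ∀ n, Measure (𝓧 n))
    (p : ℕ → ℕ) (Y : ∀ n, Fin n → 𝓧 n → Fin (p n) → ℝ)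
    (π : ∀ n, Matrix (Fin (p n)) (Fin (p n)) ℝ → ℝ) : Prop :=
  ∀ M : ℝ, 0 < M →
    TendstoZeroInProb P fun n ω => flatness n (π n) (sampleCov fun i => Y n i ω)
      (M * √((p n : ℝ) / n))

end BvM

end

/-! Write S = BᵀB and let l_i be the eigenvalues of B T Bᵀ. The likelihood ratio at T equals
exp{(n/2) ∑ (log(1 + l_i/√n) − l_i/√n)}; there is no linear term because S⁻¹ maximizes the
likelihood. The quadratic term is −∑ l_i²/4 = −tr(STST)/4, exactly the exponent of the limit law. On
the ball ‖T‖ ≤ M√p the p cubic remainders add up to O(np(M√(p/n))³) = O(M³√(p⁵/n)), which is where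
p⁵ = o(n) enters (`exists_likRatio_eq_exp_mul`). The prior is flat on the same ball, so there the
posterior density is a constant times the normal density, up to a factor near 1.

The constant need not be computed: probability densities that are nearly proportional on a set
carrying almost all the mass of both are close in L¹ (`integral_abs_sub_le_of_nearly_proportional`).
The posterior charges the ball by the contraction hypothesis, recentred from Ω₀ to S⁻¹ thanks to ‖S
− Σ₀‖ = O(√(p/n)) in probability (`IsTrueModel.measure_le_opNorm_sub_le`). The normal law charges it
by `lintegral_smnDensity_tail_le`. Both tail bounds come from exponential moments of uᵀAu for fixed
u, made uniform in u by averaging over a ball instead of using a net (`lintegral_exp_opNorm_le`).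

Flatness is assumed for each fixed M, contraction for M_n → ∞; a diagonal choice
(`exists_tendsto_diagonal`) gives one slowly growing M_n that serves both. -/

noncomputable section

namespace BvM

/-! ### The spectral norm. -/

section SpectralNorm
open scoped Matrix.Norms.L2Operator
variable {p : ℕ}

theorem opNorm_eq_norm (A : Matrix (Fin p) (Fin p) ℝ) : opNorm A = ‖A‖ := rfl

theorem opNorm_nonneg (A : Matrix (Fin p) (Fin p) ℝ) : 0 ≤ opNorm A := norm_nonneg A

theorem opNorm_mul_le (A B : Matrix (Fin p) (Fin p) ℝ) : opNorm (A * B) ≤ opNorm A * opNorm B :=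
  norm_mul_le A B

theorem opNorm_add_le (A B : Matrix (Fin p) (Fin p) ℝ) : opNorm (A + B) ≤ opNorm A + opNorm B :=
  norm_add_le A B

theorem opNorm_sub_comm (A B : Matrix (Fin p) (Fin p) ℝ) : opNorm (A - B) = opNorm (B - A) :=
  norm_sub_rev A B

theorem opNorm_smul (c : ℝ) (A : Matrix (Fin p) (Fin p) ℝ) : opNorm (c • A) = |c| * opNorm A := by
  simp only [opNorm_eq_norm, norm_smul, Real.norm_eq_abs]

theorem opNorm_transpose_mul_self (A : Matrix (Fin p) (Fin p) ℝ) :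
    opNorm (Aᵀ * A) = opNorm A * opNorm A := by
  have h := l2_opNorm_conjTranspose_mul_self A
  rwa [conjTranspose_eq_transpose_of_trivial] at h

theorem opNorm_transpose (A : Matrix (Fin p) (Fin p) ℝ) : opNorm Aᵀ = opNorm A := by
  have h := l2_opNorm_conjTranspose A
  rwa [conjTranspose_eq_transpose_of_trivial] at h

theorem opNorm_le_of_abs_eigenvalues_le {A : Matrix (Fin p) (Fin p) ℝ} (hA : A.IsHermitian)
    {c : ℝ} (hc : 0 ≤ c) (h : ∀ i, |hA.eigenvalues i| ≤ c) : opNorm A ≤ c := by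
  rw [opNorm_eq_norm, hA.spectral_theorem, Unitary.conjStarAlgAut_apply, ← Unitary.coe_star,
    CStarRing.norm_mul_coe_unitary, CStarRing.norm_coe_unitary_mul, l2_opNorm_diagonal]
  exact (pi_norm_le_iff_of_nonneg hc).2 fun i => by simpa using h i

end SpectralNorm

theorem continuous_opNorm {p : ℕ} :
    Continuous (opNorm : Matrix (Fin p) (Fin p) ℝ → ℝ) :=
  continuous_norm.comp
    (LinearMap.continuous_of_finiteDimensional
      (Matrix.toEuclideanCLM (n := Fin p) (𝕜 := ℝ)).toAlgEquiv.toLinearMap)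

theorem measurable_opNorm_comp {p : ℕ} {Ω : Type*} [MeasurableSpace Ω]
    {A : Ω → Matrix (Fin p) (Fin p) ℝ} (hA : ∀ i j, Measurable fun ω => A ω i j) :
    Measurable fun ω => opNorm (A ω) := by
  have h0 : Continuous fun B : Fin p → Fin p → ℝ => opNorm (Matrix.of B) :=
    continuous_opNorm (p := p)
  have h1 := h0.measurable
  exact h1.comp (measurable_pi_lambda _ fun i => measurable_pi_lambda _ fun j => hA i j)

/-! ### Quadratic forms, eigenvectors and the spectral norm. -/

section QuadraticForm
variable {p : ℕ}

/-- The quadratic form `uᵀ A u`. -/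
def quadForm (A : Matrix (Fin p) (Fin p) ℝ) (u : EuclideanSpace ℝ (Fin p)) : ℝ :=
  u.ofLp ⬝ᵥ (A *ᵥ u.ofLp)

theorem dotProduct_eq_inner (u v : EuclideanSpace ℝ (Fin p)) :
    u.ofLp ⬝ᵥ v.ofLp = inner ℝ u v := by
  simp [EuclideanSpace.inner_eq_star_dotProduct, dotProduct_comm]

theorem dotProduct_self_eq_norm_sq (u : EuclideanSpace ℝ (Fin p)) :
    u.ofLp ⬝ᵥ u.ofLp = ‖u‖ ^ 2 := by
  rw [dotProduct_eq_inner, real_inner_self_eq_norm_sq]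

theorem norm_toLp_mulVec_le (A : Matrix (Fin p) (Fin p) ℝ) (v : EuclideanSpace ℝ (Fin p)) :
    ‖WithLp.toLp 2 (A *ᵥ v.ofLp)‖ ≤ opNorm A * ‖v‖ := by
  have := (Matrix.toEuclideanCLM (𝕜 := ℝ) A).le_opNorm v
  rwa [Matrix.toEuclideanCLM_toLp] at this

theorem abs_dotProduct_mulVec_le (A : Matrix (Fin p) (Fin p) ℝ) (u v : EuclideanSpace ℝ (Fin p)) :
    |u.ofLp ⬝ᵥ (A *ᵥ v.ofLp)| ≤ opNorm A * ‖u‖ * ‖v‖ := by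
  have h := abs_real_inner_le_norm u (WithLp.toLp 2 (A *ᵥ v.ofLp))
  rw [← dotProduct_eq_inner] at h
  calc _ ≤ _ := h
    _ ≤ ‖u‖ * (opNorm A * ‖v‖) := by gcongr; exact norm_toLp_mulVec_le A v
    _ = _ := by ring

theorem abs_quadForm_le (A : Matrix (Fin p) (Fin p) ℝ) (u : EuclideanSpace ℝ (Fin p)) :
    |quadForm A u| ≤ opNorm A * ‖u‖ ^ 2 := by
  have := abs_dotProduct_mulVec_le A u u
  rw [quadForm]; nlinarith

theorem quadForm_sub (A B : Matrix (Fin p) (Fin p) ℝ) (u : EuclideanSpace ℝ (Fin p)) :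
    quadForm (A - B) u = quadForm A u - quadForm B u := by
  simp [quadForm, sub_mulVec, dotProduct_sub]

theorem quadForm_add (A B : Matrix (Fin p) (Fin p) ℝ) (u : EuclideanSpace ℝ (Fin p)) :
    quadForm (A + B) u = quadForm A u + quadForm B u := by
  simp [quadForm, add_mulVec, dotProduct_add]

theorem quadForm_smul (c : ℝ) (A : Matrix (Fin p) (Fin p) ℝ) (u : EuclideanSpace ℝ (Fin p)) :
    quadForm (c • A) u = c * quadForm A u := by
  simp [quadForm, smul_mulVec]

theorem isHermitian_iff_isSymm {A : Matrix (Fin p) (Fin p) ℝ} : A.IsHermitian ↔ A.IsSymm := by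
  rw [Matrix.IsHermitian, Matrix.IsSymm, conjTranspose_eq_transpose_of_trivial]

theorem dotProduct_mulVec_comm {A : Matrix (Fin p) (Fin p) ℝ} (hA : A.IsSymm) (x y : Fin p → ℝ) :
    x ⬝ᵥ (A *ᵥ y) = y ⬝ᵥ (A *ᵥ x) := by
  rw [dotProduct_mulVec, ← mulVec_transpose, hA.eq, dotProduct_comm]

/-- A symmetric matrix has a unit eigenvector whose eigenvalue is, up to sign, its norm. -/
theorem exists_eigenvector_opNorm (hp : 0 < p) {A : Matrix (Fin p) (Fin p) ℝ} (hA : A.IsSymm) :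
    ∃ (v : EuclideanSpace ℝ (Fin p)) (μ : ℝ), ‖v‖ = 1 ∧ A *ᵥ v.ofLp = μ • v.ofLp ∧
      |μ| = opNorm A := by
  have hH := isHermitian_iff_isSymm.2 hA
  have : Nonempty (Fin p) := ⟨⟨0, hp⟩⟩
  obtain ⟨i, hi⟩ := Finite.exists_max fun i => |hH.eigenvalues i|
  have hev := hH.mulVec_eigenvectorBasis i
  have hn : ‖hH.eigenvectorBasis i‖ = 1 := hH.eigenvectorBasis.orthonormal.1 i
  refine ⟨hH.eigenvectorBasis i, hH.eigenvalues i, hn, hev, le_antisymm ?_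
    (opNorm_le_of_abs_eigenvalues_le hH (abs_nonneg _) hi)⟩
  have h := norm_toLp_mulVec_le A (hH.eigenvectorBasis i)
  rw [hev, WithLp.toLp_smul, norm_smul, hn] at h
  simpa [hn] using h

theorem quadForm_of_mulVec_eq {A : Matrix (Fin p) (Fin p) ℝ} {v : EuclideanSpace ℝ (Fin p)} {μ : ℝ}
    (h : A *ᵥ v.ofLp = μ • v.ofLp) : quadForm A v = μ * ‖v‖ ^ 2 := by
  rw [quadForm, h, dotProduct_smul, dotProduct_self_eq_norm_sq, smul_eq_mul]

theorem opNorm_le_of_abs_quadForm_le (hp : 0 < p) {A : Matrix (Fin p) (Fin p) ℝ} (hA : A.IsSymm)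
    {c : ℝ} (h : ∀ u, |quadForm A u| ≤ c * ‖u‖ ^ 2) : opNorm A ≤ c := by
  obtain ⟨v, μ, hv, hμ, hn⟩ := exists_eigenvector_opNorm hp hA
  have := h v
  rw [quadForm_of_mulVec_eq hμ, hv] at this
  rw [← hn]; simpa using this

theorem posDef_of_le_quadForm {A : Matrix (Fin p) (Fin p) ℝ} (hA : A.IsSymm) {k : ℝ} (hk : 0 < k)
    (h : ∀ u, k * ‖u‖ ^ 2 ≤ quadForm A u) : A.PosDef := by
  refine Matrix.PosDef.of_dotProduct_mulVec_pos (isHermitian_iff_isSymm.2 hA) fun x hx => ?_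
  have h1 := h (WithLp.toLp 2 x)
  have h2 : 0 < ‖WithLp.toLp 2 x‖ := by
    rw [norm_pos_iff]; simpa using hx
  have h3 : 0 < quadForm A (WithLp.toLp 2 x) := lt_of_lt_of_le (by positivity) h1
  simpa [quadForm] using h3

/-- A unit eigenvector v of A⁻¹ with |μ| = ‖A⁻¹‖ satisfies v = μAv, hence 1 = μ vᵀAv, while vᵀAv ≥
k. -/
theorem opNorm_inv_le (hp : 0 < p) {A : Matrix (Fin p) (Fin p) ℝ} (hA : A.IsSymm) {k : ℝ}
    (hk : 0 < k) (h : ∀ u, k * ‖u‖ ^ 2 ≤ quadForm A u) : opNorm A⁻¹ ≤ 1 / k := by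
  have hpd := posDef_of_le_quadForm hA hk h
  have hdet : IsUnit A.det := hpd.det_pos.ne'.isUnit
  have hs : A⁻¹.IsSymm := by
    rw [Matrix.IsSymm, transpose_nonsing_inv, hA.eq]
  obtain ⟨v, μ, hv, hμ, hn⟩ := exists_eigenvector_opNorm hp hs
  have h1 : v.ofLp = μ • (A *ᵥ v.ofLp) := by
    rw [← mulVec_smul, ← hμ, mulVec_mulVec, mul_nonsing_inv _ hdet, one_mulVec]
  have h2 : 1 = μ * quadForm A v := by
    have := dotProduct_self_eq_norm_sq v
    nth_rewrite 2 [h1] at this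
    rw [dotProduct_smul, hv] at this
    rw [quadForm]; simpa using this.symm
  have h3 := h v
  rw [hv] at h3
  rw [← hn, le_div_iff₀ hk]
  have h4 : 1 = |μ| * quadForm A v := by
    have h5 : 0 ≤ quadForm A v := by nlinarith
    rw [← abs_of_nonneg h5, ← abs_mul, ← h2, abs_one]
  nlinarith [abs_nonneg μ]

theorem quadForm_bounds_of_wellConditioned {A : Matrix (Fin p) (Fin p) ℝ} {k : ℝ}
    (h : WellConditioned k A) (u : EuclideanSpace ℝ (Fin p)) :
    k * ‖u‖ ^ 2 ≤ quadForm A u ∧ quadForm A u ≤ 1 / k * ‖u‖ ^ 2 := by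
  obtain ⟨hA, hev⟩ := h
  have key : quadForm A u = ∑ i, hA.eigenvalues i * (inner ℝ (hA.eigenvectorBasis i) u) ^ 2 := by
    have h1 : quadForm A u = inner ℝ u (WithLp.toLp 2 (A *ᵥ u.ofLp)) := by
      rw [← dotProduct_eq_inner, quadForm]
    rw [h1, ← hA.eigenvectorBasis.sum_inner_mul_inner]
    refine Finset.sum_congr rfl fun i _ => ?_
    have h2 : inner ℝ (hA.eigenvectorBasis i) (WithLp.toLp 2 (A *ᵥ u.ofLp))
        = hA.eigenvalues i * inner ℝ (hA.eigenvectorBasis i) u := by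
      rw [← dotProduct_eq_inner]
      change (hA.eigenvectorBasis i).ofLp ⬝ᵥ (A *ᵥ u.ofLp) = _
      rw [dotProduct_mulVec_comm (isHermitian_iff_isSymm.1 hA), hA.mulVec_eigenvectorBasis i,
        dotProduct_smul, dotProduct_comm, dotProduct_eq_inner, smul_eq_mul]
    rw [h2, real_inner_comm]; ring
  have hn : ‖u‖ ^ 2 = ∑ i, (inner ℝ (hA.eigenvectorBasis i) u) ^ 2 := by
    simpa using (hA.eigenvectorBasis.sum_sq_norm_inner_right u).symm
  rw [key, hn, Finset.mul_sum, Finset.mul_sum]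
  exact ⟨Finset.sum_le_sum fun i _ => mul_le_mul_of_nonneg_right (hev i).1 (sq_nonneg _),
    Finset.sum_le_sum fun i _ => mul_le_mul_of_nonneg_right (hev i).2 (sq_nonneg _)⟩

/-- Near a maximal eigenvector the quadratic form remains comparable to the norm. -/
theorem exists_opNorm_le_abs_quadForm (hp : 0 < p) {A : Matrix (Fin p) (Fin p) ℝ}
    (hA : A.IsSymm) :
    ∃ v : EuclideanSpace ℝ (Fin p), ‖v‖ = 1 ∧
      ∀ u ∈ Metric.closedBall v (1 / 4), opNorm A / 4 ≤ |quadForm A u| := by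
  obtain ⟨v, μ, hv, hμ, hn⟩ := exists_eigenvector_opNorm hp hA
  refine ⟨v, hv, fun u hu => ?_⟩
  set w := u - v with hw
  have hwn : ‖w‖ ≤ 1 / 4 := by simpa [dist_eq_norm] using hu
  have hu' : u = v + w := by simp [hw]
  -- With u = v + w and ‖w‖ ≤ 1/4, the cross term is at most ‖A‖/2 and the last one at most ‖A‖/16,
  -- so 7/16 of ‖A‖ = |μ| survives.
  have h1 : quadForm A u = μ + 2 * μ * (w.ofLp ⬝ᵥ v.ofLp) + quadForm A w := by
    have h2 : w.ofLp ⬝ᵥ (A *ᵥ v.ofLp) = μ * (w.ofLp ⬝ᵥ v.ofLp) := by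
      rw [hμ, dotProduct_smul, smul_eq_mul]
    have h3 := quadForm_of_mulVec_eq hμ
    rw [hv] at h3
    rw [hu']
    simp only [quadForm, WithLp.ofLp_add, mulVec_add, dotProduct_add, add_dotProduct] at h3 ⊢
    rw [dotProduct_mulVec_comm hA v.ofLp w.ofLp, h2, h3]; ring
  have h4 : |w.ofLp ⬝ᵥ v.ofLp| ≤ 1 / 4 := by
    rw [dotProduct_eq_inner]
    have := abs_real_inner_le_norm w v
    rw [hv] at this; linarith
  have h5 := abs_quadForm_le A w
  have h0 := opNorm_nonneg A
  have h6 : ‖w‖ ^ 2 ≤ 1 / 16 := by nlinarith [norm_nonneg w]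
  have h7 : |2 * μ * (w.ofLp ⬝ᵥ v.ofLp)| ≤ opNorm A / 2 := by
    rw [abs_mul, abs_mul, hn, abs_two]; nlinarith
  have h8 : |μ| ≤ |quadForm A u| + |2 * μ * (w.ofLp ⬝ᵥ v.ofLp)| + |quadForm A w| := by
    have : μ = quadForm A u - 2 * μ * (w.ofLp ⬝ᵥ v.ofLp) - quadForm A w := by rw [h1]; ring
    calc |μ| = |quadForm A u - 2 * μ * (w.ofLp ⬝ᵥ v.ofLp) - quadForm A w| := by rw [← this]
      _ ≤ _ := (abs_sub _ _).trans (by gcongr; exact abs_sub _ _)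
  rw [hn] at h8
  nlinarith

end QuadraticForm

/-! ### From quadratic forms to the spectral norm of a random matrix. -/

section Smoothing
variable {p : ℕ} {Ω : Type*} [MeasurableSpace Ω]

/-- The exponential moment of the spectral norm of a random symmetric matrix is controlled by those
of its quadratic forms: the quadratic form is comparable to the norm on a ball of radius `1 / 4`
around some unit vector, and this ball fills a fraction `5⁻ᵖ` of the ball of radius `5 / 4`. -/
theorem lintegral_exp_opNorm_le (hp : 0 < p) (μ : Measure Ω) [SFinite μ]
    {A : Ω → Matrix (Fin p) (Fin p) ℝ} (hA : ∀ i j, Measurable fun ω => A ω i j)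
    (hs : ∀ ω, (A ω).IsSymm) {s : ℝ} (hs0 : 0 ≤ s) {B : ℝ≥0∞}
    (hB : ∀ u : EuclideanSpace ℝ (Fin p), ‖u‖ ≤ 5 / 4 →
      ∫⁻ ω, ENNReal.ofReal (Real.exp (s * |quadForm (A ω) u|)) ∂μ ≤ B) :
    ∫⁻ ω, ENNReal.ofReal (Real.exp (s * (opNorm (A ω) / 4))) ∂μ ≤ 5 ^ p * B := by
  set c : ℝ≥0∞ := volume (Metric.closedBall (0 : EuclideanSpace ℝ (Fin p)) (1 / 4)) with hc
  have hc0 : c ≠ 0 := (Metric.measure_closedBall_pos volume _ (by norm_num)).ne'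
  have hct : c ≠ ∞ := measure_closedBall_lt_top.ne
  have hbig : volume (Metric.closedBall (0 : EuclideanSpace ℝ (Fin p)) (5 / 4)) = 5 ^ p * c := by
    have h := Measure.addHaar_closedBall_mul (volume : Measure (EuclideanSpace ℝ (Fin p))) 0
      (r := 5) (by norm_num) (s := 1 / 4) (by norm_num)
    rw [show (5 : ℝ) * (1 / 4) = 5 / 4 by norm_num] at h
    rw [h, hc, finrank_euclideanSpace_fin, ENNReal.ofReal_pow (by norm_num)]
    norm_num
  -- The good ball around the eigenvector depends on ω. The ball of radius 5/4 containing it does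
  -- not, so Tonelli can exchange the integrals.
  have hpt : ∀ ω, ENNReal.ofReal (Real.exp (s * (opNorm (A ω) / 4))) * c ≤
      ∫⁻ u in Metric.closedBall (0 : EuclideanSpace ℝ (Fin p)) (5 / 4),
        ENNReal.ofReal (Real.exp (s * |quadForm (A ω) u|)) := by
    intro ω
    obtain ⟨v, hv, hball⟩ := exists_opNorm_le_abs_quadForm hp (hs ω)
    have hsub : Metric.closedBall v (1 / 4) ⊆
        Metric.closedBall (0 : EuclideanSpace ℝ (Fin p)) (5 / 4) := by
      apply Metric.closedBall_subset_closedBall'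
      rw [dist_zero_right, hv]; norm_num
    calc _ = ∫⁻ u in Metric.closedBall v (1 / 4),
          ENNReal.ofReal (Real.exp (s * (opNorm (A ω) / 4))) := by
          rw [setLIntegral_const, hc]
          congr 1
          exact (Measure.addHaar_closedBall_center volume v (1 / 4)).symm
      _ ≤ ∫⁻ u in Metric.closedBall v (1 / 4),
          ENNReal.ofReal (Real.exp (s * |quadForm (A ω) u|)) := by
          refine setLIntegral_mono' measurableSet_closedBall fun u hu => ?_
          have := hball u hu
          gcongr
      _ ≤ _ := lintegral_mono_set hsub
  have hmeas : Measurable fun z : Ω × EuclideanSpace ℝ (Fin p) =>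
      ENNReal.ofReal (Real.exp (s * |quadForm (A z.1) z.2|)) := by
    have : Measurable fun z : Ω × EuclideanSpace ℝ (Fin p) => quadForm (A z.1) z.2 := by
      simp only [quadForm, dotProduct, mulVec]
      have h1 : ∀ i, Measurable fun z : Ω × EuclideanSpace ℝ (Fin p) => z.2.ofLp i := fun i => by
        fun_prop
      exact Finset.measurable_sum _ fun i _ => (h1 i).mul
        (Finset.measurable_sum _ fun j _ => ((hA i j).comp measurable_fst).mul (h1 j))
    exact (Real.measurable_exp.comp (measurable_const.mul this.abs)).ennreal_ofReal
  have hmain : (∫⁻ ω, ENNReal.ofReal (Real.exp (s * (opNorm (A ω) / 4))) ∂μ) * c ≤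
      5 ^ p * B * c := by
    rw [← lintegral_mul_const' _ _ hct]
    calc _ ≤ ∫⁻ ω, ∫⁻ u in Metric.closedBall (0 : EuclideanSpace ℝ (Fin p)) (5 / 4),
        ENNReal.ofReal (Real.exp (s * |quadForm (A ω) u|)) ∂volume ∂μ := lintegral_mono hpt
      _ = ∫⁻ u in Metric.closedBall (0 : EuclideanSpace ℝ (Fin p)) (5 / 4), ∫⁻ ω,
        ENNReal.ofReal (Real.exp (s * |quadForm (A ω) u|)) ∂μ := by
          rw [lintegral_lintegral_swap hmeas.aemeasurable]
      _ ≤ ∫⁻ u in Metric.closedBall (0 : EuclideanSpace ℝ (Fin p)) (5 / 4), B :=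
          setLIntegral_mono' measurableSet_closedBall fun u hu => hB u (by simpa using hu)
      _ = _ := by rw [setLIntegral_const, hbig]; ring
  exact (ENNReal.mul_le_mul_iff_left hc0 hct).1 hmain

/-- Exponential tail bound for the norm of a random symmetric matrix. -/
theorem measure_le_opNorm_le (hp : 0 < p) (μ : Measure Ω) [SFinite μ]
    {A : Ω → Matrix (Fin p) (Fin p) ℝ} (hA : ∀ i j, Measurable fun ω => A ω i j)
    (hs : ∀ ω, (A ω).IsSymm) {s : ℝ} (hs0 : 0 ≤ s) {b : ℝ}
    (hB : ∀ u : EuclideanSpace ℝ (Fin p), ‖u‖ ≤ 5 / 4 →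
      ∫⁻ ω, ENNReal.ofReal (Real.exp (s * |quadForm (A ω) u|)) ∂μ ≤ ENNReal.ofReal b) (x : ℝ) :
    μ {ω | x ≤ opNorm (A ω)} ≤ ENNReal.ofReal (5 ^ p * b * Real.exp (-(s * (x / 4)))) := by
  have h1 := lintegral_exp_opNorm_le hp μ hA hs hs0 hB
  have hm : Measurable fun ω => ENNReal.ofReal (Real.exp (s * (opNorm (A ω) / 4))) :=
    (Real.measurable_exp.comp (measurable_const.mul
      ((measurable_opNorm_comp hA).div_const 4))).ennreal_ofReal
  have h2 := mul_meas_ge_le_lintegral (μ := μ) hm (ENNReal.ofReal (Real.exp (s * (x / 4))))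
  have h3 : μ {ω | x ≤ opNorm (A ω)} ≤ μ {ω | ENNReal.ofReal (Real.exp (s * (x / 4))) ≤
      ENNReal.ofReal (Real.exp (s * (opNorm (A ω) / 4)))} := by
    refine measure_mono fun ω hω => ?_
    have hω' : x ≤ opNorm (A ω) := hω
    exact ENNReal.ofReal_le_ofReal (by gcongr)
  have h4 : (5 : ℝ≥0∞) ^ p * ENNReal.ofReal b = ENNReal.ofReal (5 ^ p * b) := by
    rw [ENNReal.ofReal_mul (by positivity), ENNReal.ofReal_pow (by norm_num)]
    norm_num
  rw [h4] at h1
  have h5 := (mul_le_mul_right h3 (ENNReal.ofReal (Real.exp (s * (x / 4))))).trans (h2.trans h1)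
  rw [Real.exp_neg, ← div_eq_mul_inv, ENNReal.ofReal_div_of_pos (Real.exp_pos _),
    ENNReal.le_div_iff_mul_le (Or.inl (by simp [Real.exp_pos])) (Or.inl ENNReal.ofReal_ne_top),
    mul_comm]
  exact h5

end Smoothing

/-! ### Exponential moments from sub-Gaussian moment bounds. -/

section Moments
variable {Ω : Type*} [MeasurableSpace Ω] {μ : Measure Ω} {X : Ω → ℝ} {K : ℝ}

theorem lintegral_even_pow_le (hK : 0 ≤ K)
    (h : ∀ q : ℝ, 1 ≤ q → eLpNorm X (ENNReal.ofReal q) μ ≤ ENNReal.ofReal (K * √q))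
    {m : ℕ} (hm : m ≠ 0) :
    ∫⁻ ω, ENNReal.ofReal ((X ω ^ 2) ^ m) ∂μ ≤ ENNReal.ofReal ((2 * K ^ 2 * m) ^ m) := by
  have hm1 : (1 : ℝ) ≤ m := by exact_mod_cast Nat.one_le_iff_ne_zero.2 hm
  have hq : (0 : ℝ) < 2 * m := by linarith
  have h1 := h (2 * m) (by linarith)
  rw [eLpNorm_eq_lintegral_rpow_enorm_toReal (by simpa using hm) ENNReal.ofReal_ne_top,
    ENNReal.toReal_ofReal hq.le] at h1
  have h2 := ENNReal.rpow_le_rpow h1 hq.le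
  rw [← ENNReal.rpow_mul, one_div, inv_mul_cancel₀ hq.ne', ENNReal.rpow_one] at h2
  refine le_trans (le_of_eq (lintegral_congr fun ω => ?_)) (h2.trans (le_of_eq ?_))
  · rw [Real.enorm_eq_ofReal_abs, ENNReal.ofReal_rpow_of_nonneg (abs_nonneg _) hq.le]
    congr 1
    rw [← sq_abs, ← pow_mul, ← Real.rpow_natCast]; push_cast; rfl
  · rw [ENNReal.ofReal_rpow_of_nonneg (by positivity) hq.le]
    congr 1
    rw [show (2 * (m : ℝ)) = ((2 * m : ℕ) : ℝ) by push_cast; rfl, Real.rpow_natCast, pow_mul,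
      mul_pow, Real.sq_sqrt (by positivity)]
    push_cast; ring

/-- Integrate the exponential series termwise. Since m^m/m! ≤ e^m ≤ 3^m, the m-th term is at most
(6aK²)^m ≤ 2^(−m); this dictates the constant 12. -/
theorem lintegral_exp_mul_sq_le [IsProbabilityMeasure μ] (hX : AEMeasurable X μ) (hK : 0 < K)
    (h : ∀ q : ℝ, 1 ≤ q → eLpNorm X (ENNReal.ofReal q) μ ≤ ENNReal.ofReal (K * √q))
    {a : ℝ} (ha0 : 0 ≤ a) (ha : 12 * a * K ^ 2 ≤ 1) :
    ∫⁻ ω, ENNReal.ofReal (Real.exp (a * X ω ^ 2)) ∂μ ≤ 2 := by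
  have h1 : ∀ ω, ENNReal.ofReal (Real.exp (a * X ω ^ 2)) =
      ∑' m : ℕ, ENNReal.ofReal (a ^ m / m.factorial) * ENNReal.ofReal ((X ω ^ 2) ^ m) := by
    intro ω
    have hs := NormedSpace.expSeries_div_hasSum_exp (𝔸 := ℝ) (a * X ω ^ 2)
    rw [← Real.exp_eq_exp_ℝ] at hs
    rw [← hs.tsum_eq, ENNReal.ofReal_tsum_of_nonneg (fun m => by positivity) hs.summable]
    refine tsum_congr fun m => ?_
    rw [← ENNReal.ofReal_mul (by positivity), mul_pow]
    congr 1; ring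
  simp_rw [h1]
  rw [lintegral_tsum fun m => ((hX.pow_const 2).pow_const m).ennreal_ofReal.const_mul _]
  have h2 : ∀ m : ℕ, ∫⁻ ω, ENNReal.ofReal (a ^ m / m.factorial) *
      ENNReal.ofReal ((X ω ^ 2) ^ m) ∂μ ≤ (2⁻¹ : ℝ≥0∞) ^ m := by
    intro m
    rw [lintegral_const_mul' _ _ ENNReal.ofReal_ne_top]
    rcases eq_or_ne m 0 with rfl | hm
    · simp
    calc _ ≤ ENNReal.ofReal (a ^ m / m.factorial) * ENNReal.ofReal ((2 * K ^ 2 * m) ^ m) := by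
          gcongr; exact lintegral_even_pow_le hK.le h hm
      _ = ENNReal.ofReal ((2 * a * K ^ 2) ^ m * ((m : ℝ) ^ m / m.factorial)) := by
          rw [← ENNReal.ofReal_mul (by positivity)]
          congr 1
          simp only [mul_pow]; ring
      _ ≤ ENNReal.ofReal ((1 / 2 : ℝ) ^ m) := by
          apply ENNReal.ofReal_le_ofReal
          have e1 : (m : ℝ) ^ m / m.factorial ≤ 3 ^ m := by
            refine (Real.pow_div_factorial_le_exp _ (Nat.cast_nonneg m) m).trans ?_
            rw [← Real.exp_one_pow]
            exact pow_le_pow_left₀ (Real.exp_pos _).le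
              (Real.exp_one_lt_d9.le.trans (by norm_num)) _
          calc _ ≤ (2 * a * K ^ 2) ^ m * 3 ^ m := by gcongr
            _ = (6 * a * K ^ 2) ^ m := by rw [← mul_pow]; ring
            _ ≤ _ := pow_le_pow_left₀ (by positivity) (by linarith) _
      _ = _ := by
          rw [ENNReal.ofReal_pow (by norm_num), one_div,
            ENNReal.ofReal_inv_of_pos (by norm_num)]
          norm_num
  calc _ ≤ ∑' m : ℕ, (2⁻¹ : ℝ≥0∞) ^ m := ENNReal.tsum_le_tsum h2
    _ = 2 := by rw [ENNReal.tsum_geometric, ENNReal.one_sub_inv_two, inv_inv]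

/-- Both signs of x follow from x ≤ eˣ − 1 ≤ x eˣ. -/
theorem exp_le_one_add_add_sq_mul (x : ℝ) : Real.exp x ≤ 1 + x + x ^ 2 * Real.exp |x| := by
  have h1 : Real.exp x - 1 ≤ x * Real.exp x := by
    have h := mul_le_mul_of_nonneg_right (Real.add_one_le_exp (-x)) (Real.exp_pos x).le
    rw [← Real.exp_add, neg_add_cancel, Real.exp_zero] at h
    linarith
  have h2 := Real.add_one_le_exp x
  rcases le_total 0 x with hx | hx
  · rw [abs_of_nonneg hx]; nlinarith
  · have h3 : 1 ≤ Real.exp |x| := Real.one_le_exp (abs_nonneg x)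
    nlinarith [sq_nonneg x]

/-- The square is absorbed by (y|x|)² ≤ 2 exp(y|x|). The point is to keep the factor l² in front of
an exponential whose rate no longer depends on l. -/
theorem exp_mul_le_one_add_add {x y l : ℝ} (hl : |l| ≤ y) (hy : 0 < y) :
    Real.exp (l * x) ≤ 1 + l * x + 2 * (l ^ 2 / y ^ 2) * Real.exp (2 * y * |x|) := by
  have h1 := exp_le_one_add_add_sq_mul (l * x)
  have h2 : (l * x) ^ 2 * Real.exp |l * x| ≤ 2 * (l ^ 2 / y ^ 2) * Real.exp (2 * y * |x|) := by
    have e1 : |l * x| ≤ y * |x| := by rw [abs_mul]; gcongr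
    have e2 : (y * |x|) ^ 2 ≤ 2 * Real.exp (y * |x|) := by
      have h0 : 0 ≤ y * |x| := by positivity
      have := Real.quadratic_le_exp_of_nonneg h0
      linarith
    calc (l * x) ^ 2 * Real.exp |l * x| = l ^ 2 / y ^ 2 * ((y * |x|) ^ 2 * Real.exp |l * x|) := by
          rw [mul_pow, mul_pow, sq_abs]; field_simp
      _ ≤ l ^ 2 / y ^ 2 * (2 * Real.exp (y * |x|) * Real.exp (y * |x|)) := by gcongr
      _ = 2 * (l ^ 2 / y ^ 2) * (Real.exp (y * |x|) * Real.exp (y * |x|)) := by ring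
      _ = _ := by rw [← Real.exp_add]; ring_nf
  linarith

theorem memLp_two_of_eLpNorm_le (hX : AEStronglyMeasurable X μ)
    (h : ∀ q : ℝ, 1 ≤ q → eLpNorm X (ENNReal.ofReal q) μ ≤ ENNReal.ofReal (K * √q)) :
    MemLp X 2 μ := by
  have := h 2 (by norm_num)
  rw [show ENNReal.ofReal 2 = 2 by norm_num] at this
  exact ⟨hX, this.trans_lt ENNReal.ofReal_lt_top⟩

/-- The centred square of a sub-Gaussian variable is sub-exponential. -/
theorem mgf_sq_sub_integral_le [IsProbabilityMeasure μ] (hX : AEMeasurable X μ) (hK : 0 < K)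
    (h : ∀ q : ℝ, 1 ≤ q → eLpNorm X (ENNReal.ofReal q) μ ≤ ENNReal.ofReal (K * √q))
    {l : ℝ} (hl : |l| ≤ 1 / (24 * K ^ 2)) :
    Integrable (fun ω => Real.exp (l * (X ω ^ 2 - ∫ ω, X ω ^ 2 ∂μ))) μ ∧
      mgf (fun ω => X ω ^ 2 - ∫ ω, X ω ^ 2 ∂μ) μ l ≤
        Real.exp (8 * l ^ 2 / (1 / (24 * K ^ 2)) ^ 2) := by
  set y : ℝ := 1 / (24 * K ^ 2) with hy
  have hy0 : 0 < y := by positivity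
  set e : ℝ := ∫ ω, X ω ^ 2 ∂μ with he
  have h2 := memLp_two_of_eLpNorm_le hX.aestronglyMeasurable h
  have hi2 : Integrable (fun ω => X ω ^ 2) μ := h2.integrable_sq
  have he0 : 0 ≤ e := integral_nonneg fun ω => sq_nonneg _
  have he2 : e ≤ 2 * K ^ 2 := by
    have := lintegral_even_pow_le hK.le h one_ne_zero
    simp only [pow_one, Nat.cast_one, mul_one] at this
    rw [he, integral_eq_lintegral_of_nonneg_ae (ae_of_all _ fun ω => sq_nonneg _)
      hi2.aestronglyMeasurable]
    exact ENNReal.toReal_le_of_le_ofReal (by positivity) this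
  -- At rate 2y the requirement 12 · 2y · K² ≤ 1 is an equality; this is the origin of the constant
  -- 24.
  have hexp := lintegral_exp_mul_sq_le hX hK h (a := 2 * y) (by positivity)
    (by rw [hy]; field_simp; norm_num)
  have hm : AEStronglyMeasurable (fun ω => Real.exp (2 * y * X ω ^ 2)) μ :=
    (Real.measurable_exp.comp_aemeasurable ((hX.pow_const 2).const_mul _)).aestronglyMeasurable
  have hI : Integrable (fun ω => Real.exp (2 * y * X ω ^ 2)) μ := by
    refine ⟨hm, ?_⟩
    rw [hasFiniteIntegral_iff_ofReal (ae_of_all _ fun ω => (Real.exp_pos _).le)]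
    exact hexp.trans_lt (by norm_num)
  have hIle : ∫ ω, Real.exp (2 * y * X ω ^ 2) ∂μ ≤ 2 := by
    rw [integral_eq_lintegral_of_nonneg_ae (ae_of_all _ fun ω => (Real.exp_pos _).le) hm]
    refine ENNReal.toReal_le_of_le_ofReal (by norm_num) (hexp.trans (by norm_num))
  -- Since the mean is at most 2K², centring costs a factor exp(4yK²) = exp(1/6) ≤ 2.
  have hpt : ∀ ω, Real.exp (2 * y * |X ω ^ 2 - e|) ≤ 2 * Real.exp (2 * y * X ω ^ 2) := by
    intro ω
    have h3 : |X ω ^ 2 - e| ≤ X ω ^ 2 + 2 * K ^ 2 := by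
      rw [abs_le]; constructor <;> nlinarith [sq_nonneg (X ω)]
    have h4 : Real.exp (2 * y * (2 * K ^ 2)) ≤ 2 := by
      have : 2 * y * (2 * K ^ 2) = 1 / 6 := by rw [hy]; field_simp; norm_num
      rw [this]
      have h6 : Real.exp (1 / 6) ≤ Real.exp (Real.log 2) := by
        gcongr; linarith [Real.log_two_gt_d9]
      rwa [Real.exp_log (by norm_num)] at h6
    calc _ ≤ Real.exp (2 * y * (X ω ^ 2 + 2 * K ^ 2)) := by gcongr
      _ = Real.exp (2 * y * (2 * K ^ 2)) * Real.exp (2 * y * X ω ^ 2) := by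
          rw [← Real.exp_add]; ring_nf
      _ ≤ _ := by gcongr
  have hle : ∀ ω, Real.exp (l * (X ω ^ 2 - e)) ≤
      1 + l * (X ω ^ 2 - e) + 4 * (l ^ 2 / y ^ 2) * Real.exp (2 * y * X ω ^ 2) := by
    intro ω
    have h3 := exp_mul_le_one_add_add (x := X ω ^ 2 - e) hl hy0
    have h4 := mul_le_mul_of_nonneg_left (hpt ω) (by positivity : 0 ≤ 2 * (l ^ 2 / y ^ 2))
    linarith
  have hi : Integrable (fun ω => 1 + l * (X ω ^ 2 - e)) μ :=
    (integrable_const _).add ((hi2.sub (integrable_const _)).const_mul _)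
  have hi' : Integrable (fun ω => 1 + l * (X ω ^ 2 - e) +
      4 * (l ^ 2 / y ^ 2) * Real.exp (2 * y * X ω ^ 2)) μ := hi.add (hI.const_mul _)
  have hint : Integrable (fun ω => Real.exp (l * (X ω ^ 2 - e))) μ := by
    refine hi'.mono' (Real.measurable_exp.comp_aemeasurable
      (((hX.pow_const 2).sub_const _).const_mul _)).aestronglyMeasurable (ae_of_all _ fun ω => ?_)
    rw [Real.norm_eq_abs, abs_of_pos (Real.exp_pos _)]
    exact hle ω
  refine ⟨hint, ?_⟩
  -- Centring kills the linear term, so the excess over 1 is quadratic in l.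
  have hz : ∫ ω, (1 + l * (X ω ^ 2 - e)) ∂μ = 1 := by
    have hc : Integrable (fun ω => X ω ^ 2 - e) μ := hi2.sub (integrable_const _)
    rw [integral_add (integrable_const _) (hc.const_mul _), integral_const_mul, integral_sub hi2 (integrable_const _)]
    simp [he]
  calc mgf (fun ω => X ω ^ 2 - e) μ l ≤ ∫ ω, (1 + l * (X ω ^ 2 - e) +
      4 * (l ^ 2 / y ^ 2) * Real.exp (2 * y * X ω ^ 2)) ∂μ := integral_mono hint hi' hle
    _ = 1 + 4 * (l ^ 2 / y ^ 2) * ∫ ω, Real.exp (2 * y * X ω ^ 2) ∂μ := by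
        rw [integral_add hi (hI.const_mul _), hz, integral_const_mul]
    _ ≤ 1 + 4 * (l ^ 2 / y ^ 2) * 2 := by gcongr
    _ ≤ Real.exp (8 * l ^ 2 / y ^ 2) := by
        have := Real.add_one_le_exp (8 * l ^ 2 / y ^ 2)
        have e : 4 * (l ^ 2 / y ^ 2) * 2 = 8 * l ^ 2 / y ^ 2 := by ring
        linarith

theorem lintegral_exp_mul_abs_le (hX : Measurable X) (s : ℝ) {b : ℝ}
    (h1 : ∫⁻ ω, ENNReal.ofReal (Real.exp (s * X ω)) ∂μ ≤ ENNReal.ofReal b)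
    (h2 : ∫⁻ ω, ENNReal.ofReal (Real.exp (-s * X ω)) ∂μ ≤ ENNReal.ofReal b) :
    ∫⁻ ω, ENNReal.ofReal (Real.exp (s * |X ω|)) ∂μ ≤ ENNReal.ofReal (2 * b) := by
  have hm : Measurable fun ω => ENNReal.ofReal (Real.exp (s * X ω)) :=
    (Real.measurable_exp.comp (hX.const_mul s)).ennreal_ofReal
  calc _ ≤ ∫⁻ ω, (ENNReal.ofReal (Real.exp (s * X ω)) +
        ENNReal.ofReal (Real.exp (-s * X ω))) ∂μ := by
        refine lintegral_mono fun ω => ?_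
        rw [← ENNReal.ofReal_add (Real.exp_pos _).le (Real.exp_pos _).le]
        apply ENNReal.ofReal_le_ofReal
        have h0 := Real.exp_pos (s * X ω)
        have h0' := Real.exp_pos (-s * X ω)
        rcases abs_choice (X ω) with e | e
        · rw [e]; linarith
        · rw [e, mul_neg, ← neg_mul]; linarith
    _ ≤ ENNReal.ofReal b + ENNReal.ofReal b := by
        rw [lintegral_add_left hm]
        exact add_le_add h1 h2
    _ = _ := by
        rw [ENNReal.ofReal_mul (by norm_num), ENNReal.ofReal_ofNat, two_mul]

theorem five_pow_le_exp (m : ℕ) : (5 : ℝ) ^ m ≤ Real.exp (2 * m) := by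
  have h5 : (5 : ℝ) ≤ Real.exp 2 := by
    have := Real.quadratic_le_exp_of_nonneg (show (0 : ℝ) ≤ 2 by norm_num)
    linarith
  calc (5 : ℝ) ^ m ≤ Real.exp 2 ^ m := by gcongr
    _ = _ := by rw [← Real.exp_nat_mul]; ring_nf

end Moments

/-! ### Square root of the covariance matrix. -/

section SquareRoot
variable {p : ℕ}

/-- A square root of a well-conditioned matrix, inverse to `invSqrt`. -/
theorem WellConditioned.exists_sqrt {A : Matrix (Fin p) (Fin p) ℝ} {k : ℝ} (hk : 0 < k)
    (h : WellConditioned k A) :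
    ∃ Q : Matrix (Fin p) (Fin p) ℝ, Q.IsSymm ∧ Q * invSqrt A = 1 ∧ Q * Q = A := by
  obtain ⟨hA, hev⟩ := h
  have hpos : ∀ x ∈ spectrum ℝ A, 0 < x := by
    intro x hx
    rw [hA.spectrum_real_eq_range_eigenvalues] at hx
    obtain ⟨i, rfl⟩ := hx
    exact hk.trans_le (hev i).1
  have hfin : (spectrum ℝ A).Finite := by
    rw [hA.spectrum_real_eq_range_eigenvalues]; exact Set.finite_range _
  have hA' : IsSelfAdjoint A := hA
  refine ⟨cfc Real.sqrt A, isHermitian_iff_isSymm.1 (cfc_predicate Real.sqrt A), ?_, ?_⟩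
  · rw [invSqrt, ← cfc_mul _ _ _ (hfin.continuousOn _) (hfin.continuousOn _)]
    rw [cfc_congr (g := fun _ => (1 : ℝ))]
    · exact cfc_const_one ℝ A
    · intro x hx
      exact mul_inv_cancel₀ (Real.sqrt_pos.2 (hpos x hx)).ne'
  · rw [← cfc_mul _ _ _ (hfin.continuousOn _) (hfin.continuousOn _), cfc_congr (g := fun x => x)]
    · exact cfc_id' ℝ A
    · intro x hx
      exact Real.mul_self_sqrt (hpos x hx).le

end SquareRoot

/-! ### Concentration of the sample covariance matrix. -/

section Model
variable {𝓧 : Type*} [MeasurableSpace 𝓧] {P : Measure 𝓧} {n p : ℕ}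
  {Y : Fin n → 𝓧 → Fin p → ℝ} {Sigma0 : Matrix (Fin p) (Fin p) ℝ} {k σ₀ : ℝ}

theorem eLpNorm_le_of_subGaussianNormVec_le {Z : 𝓧 → Fin p → ℝ} {s : ℝ}
    (h : subGaussianNormVec P Z ≤ ENNReal.ofReal s) (v : EuclideanSpace ℝ (Fin p)) {q : ℝ}
    (hq : 1 ≤ q) :
    eLpNorm (fun ω => v.ofLp ⬝ᵥ Z ω) (ENNReal.ofReal q) P ≤ ENNReal.ofReal (s * ‖v‖ * √q) := by
  rcases eq_or_ne v 0 with rfl | hv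
  · simp
  have hv' : ‖v‖ ≠ 0 := norm_ne_zero_iff.2 hv
  have hqp : 0 < √q := Real.sqrt_pos.2 (by linarith)
  set u : EuclideanSpace ℝ (Fin p) := ‖v‖⁻¹ • v with hu
  have hun : ‖u‖ = 1 := by rw [hu, norm_smul, norm_inv, norm_norm, inv_mul_cancel₀ hv']
  have hvu : (fun ω => v.ofLp ⬝ᵥ Z ω) = ‖v‖ • fun ω => u.ofLp ⬝ᵥ Z ω := by
    ext ω
    simp only [Pi.smul_apply, hu, WithLp.ofLp_smul, smul_dotProduct, smul_eq_mul]
    rw [← mul_assoc, mul_inv_cancel₀ hv', one_mul]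
  have h1 : ENNReal.ofReal (√q)⁻¹ * eLpNorm (fun ω => u.ofLp ⬝ᵥ Z ω) (ENNReal.ofReal q) P ≤
      ENNReal.ofReal s := by
    refine le_trans ?_ h
    refine le_trans ?_ (le_iSup₂ (f := fun (u : EuclideanSpace ℝ (Fin p)) (_ : ‖u‖ = 1) =>
      subGaussianNorm P fun ω => u.ofLp ⬝ᵥ Z ω) u hun)
    exact le_iSup₂ (f := fun (q : ℝ) (_ : 1 ≤ q) => ENNReal.ofReal (√q)⁻¹ *
      eLpNorm (fun ω => u.ofLp ⬝ᵥ Z ω) (ENNReal.ofReal q) P) q hq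
  have h2 : eLpNorm (fun ω => u.ofLp ⬝ᵥ Z ω) (ENNReal.ofReal q) P ≤ ENNReal.ofReal (√q * s) := by
    have h3 := mul_le_mul_right h1 (ENNReal.ofReal (√q))
    rwa [← mul_assoc, ← ENNReal.ofReal_mul hqp.le, mul_inv_cancel₀ hqp.ne', ENNReal.ofReal_one,
      one_mul, ← ENNReal.ofReal_mul hqp.le] at h3
  rw [hvu, eLpNorm_const_smul]
  calc _ ≤ ‖‖v‖‖ₑ * ENNReal.ofReal (√q * s) := by gcongr
    _ = _ := by
      rw [Real.enorm_of_nonneg (norm_nonneg v), ← ENNReal.ofReal_mul (norm_nonneg v)]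
      congr 1; ring

/-- With Q = Σ₀^(1/2), uᵀY = (Qu)ᵀ(Σ₀^(−1/2)Y) and ‖Qu‖² = uᵀΣ₀u ≤ ‖u‖²/k. -/
theorem IsTrueModel.eLpNorm_dotProduct_le (h : IsTrueModel P Y Sigma0 k σ₀) (hk : 0 < k)
    (hσ : 0 ≤ σ₀) (i : Fin n) (u : EuclideanSpace ℝ (Fin p)) {r : ℝ} (hu : ‖u‖ ≤ r) {q : ℝ}
    (hq : 1 ≤ q) :
    eLpNorm (fun ω => u.ofLp ⬝ᵥ Y i ω) (ENNReal.ofReal q) P ≤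
      ENNReal.ofReal (σ₀ * (√(1 / k) * r) * √q) := by
  obtain ⟨Q, hQs, hQi, hQ2⟩ := h.wellConditioned.exists_sqrt hk
  have h1 := eLpNorm_le_of_subGaussianNormVec_le (h.subGaussian i)
    (WithLp.toLp 2 (Q *ᵥ u.ofLp)) hq
  have h2 : ∀ ω, (Q *ᵥ u.ofLp) ⬝ᵥ (invSqrt Sigma0 *ᵥ Y i ω) = u.ofLp ⬝ᵥ Y i ω := by
    intro ω
    rw [dotProduct_comm, dotProduct_mulVec_comm hQs, mulVec_mulVec, hQi, one_mulVec]
  have h3 : ‖WithLp.toLp 2 (Q *ᵥ u.ofLp)‖ ≤ √(1 / k) * r := by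
    have e1 : ‖WithLp.toLp 2 (Q *ᵥ u.ofLp)‖ ^ 2 = quadForm Sigma0 u := by
      rw [← dotProduct_self_eq_norm_sq, quadForm, ← hQ2, ← mulVec_mulVec]
      change (Q *ᵥ u.ofLp) ⬝ᵥ (Q *ᵥ u.ofLp) = _
      rw [dotProduct_mulVec_comm hQs]
    have e2 := (quadForm_bounds_of_wellConditioned h.wellConditioned u).2
    rw [← e1] at e2
    refine le_trans (Real.le_sqrt_of_sq_le e2) ?_
    rw [Real.sqrt_mul (by positivity), Real.sqrt_sq (norm_nonneg u)]
    gcongr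
  simp only [h2] at h1
  refine h1.trans (ENNReal.ofReal_le_ofReal ?_)
  gcongr

theorem measurable_sampleCov_apply (hY : ∀ i, Measurable (Y i)) (a b : Fin p) :
    Measurable fun ω => sampleCov (fun i => Y i ω) a b := by
  simp only [sampleCov, Matrix.smul_apply, Matrix.sum_apply, vecMulVec_apply, smul_eq_mul]
  exact (Finset.measurable_sum _ fun i _ =>
    (measurable_pi_iff.1 (hY i) a).mul (measurable_pi_iff.1 (hY i) b)).const_mul _

theorem isSymm_sampleCov (y : Fin n → Fin p → ℝ) : (sampleCov y).IsSymm := by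
  ext a b
  simp only [sampleCov, transpose_apply, Matrix.smul_apply, Matrix.sum_apply, vecMulVec_apply]
  congr 1
  exact Finset.sum_congr rfl fun i _ => mul_comm _ _

theorem WellConditioned.isSymm {A : Matrix (Fin p) (Fin p) ℝ} (h : WellConditioned k A) :
    A.IsSymm := by
  obtain ⟨h, -⟩ := h
  exact isHermitian_iff_isSymm.1 h

theorem IsTrueModel.integral_sq_dotProduct [IsProbabilityMeasure P]
    (h : IsTrueModel P Y Sigma0 k σ₀) (hk : 0 < k) (hσ : 0 ≤ σ₀) (i : Fin n)
    (u : EuclideanSpace ℝ (Fin p)) :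
    ∫ ω, (u.ofLp ⬝ᵥ Y i ω) ^ 2 ∂P = quadForm Sigma0 u := by
  have hL : ∀ a, MemLp (fun ω => Y i ω a) 2 P := by
    intro a
    have := memLp_two_of_eLpNorm_le (X := fun ω => Y i ω a) (μ := P)
      (K := σ₀ * (√(1 / k) * 1)) (measurable_pi_iff.1 (h.measurable i) a).aestronglyMeasurable
    refine this fun q hq => ?_
    have := h.eLpNorm_dotProduct_le hk hσ i (EuclideanSpace.single a 1) (r := 1) (by simp) hq
    simpa using this
  have hint : ∀ a b, Integrable (fun ω => Y i ω a * Y i ω b) P := fun a b =>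
    (hL a).integrable_mul (hL b)
  have h1 : ∀ ω, (u.ofLp ⬝ᵥ Y i ω) ^ 2 =
      ∑ a, ∑ b, u.ofLp a * u.ofLp b * (Y i ω a * Y i ω b) := by
    intro ω
    rw [sq, dotProduct, Finset.sum_mul_sum]
    exact Finset.sum_congr rfl fun a _ => Finset.sum_congr rfl fun b _ => by ring
  simp_rw [h1]
  rw [integral_finsetSum _ fun a _ => integrable_finsetSum _ fun b _ => (hint a b).const_mul _]
  simp_rw [integral_finsetSum _ fun b _ => (hint _ b).const_mul _, integral_const_mul,
    h.covariance]
  simp only [quadForm, dotProduct, mulVec, Finset.mul_sum]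
  exact Finset.sum_congr rfl fun a _ => Finset.sum_congr rfl fun b _ => by ring

theorem quadForm_sampleCov (y : Fin n → Fin p → ℝ) (u : EuclideanSpace ℝ (Fin p)) :
    quadForm (sampleCov y) u = (n : ℝ)⁻¹ * ∑ i, (u.ofLp ⬝ᵥ y i) ^ 2 := by
  rw [sampleCov, quadForm_smul, quadForm, sum_mulVec, dotProduct_sum]
  congr 1
  refine Finset.sum_congr rfl fun i _ => ?_
  rw [vecMulVec_mulVec, dotProduct_smul, dotProduct_comm (y i)]
  simp [sq]

/-- Exponential moments of the quadratic forms of `S - Σ₀`. -/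
theorem IsTrueModel.lintegral_exp_quadForm_le [IsProbabilityMeasure P]
    (h : IsTrueModel P Y Sigma0 k σ₀) (hk : 0 < k) (hσ : 0 < σ₀) (hn : 0 < n)
    {u : EuclideanSpace ℝ (Fin p)} (hu : ‖u‖ ≤ 5 / 4) {y l : ℝ}
    (hy : y = 1 / (24 * (σ₀ * (√(1 / k) * (5 / 4))) ^ 2)) (hl0 : 0 ≤ l) (hl : l ≤ y) :
    ∫⁻ ω, ENNReal.ofReal (Real.exp (n * l * |quadForm (sampleCov (fun i => Y i ω) - Sigma0) u|)) ∂P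
      ≤ ENNReal.ofReal (2 * Real.exp (8 * n * l ^ 2 / y ^ 2)) := by
  -- K is the moment constant of uᵀY for all ‖u‖ ≤ 5/4, the radius used in the smoothing argument.
  set K : ℝ := σ₀ * (√(1 / k) * (5 / 4))
  have hK : 0 < K := by have := Real.sqrt_pos.2 (one_div_pos.2 hk); positivity
  set Z : Fin n → 𝓧 → ℝ := fun i ω => (u.ofLp ⬝ᵥ Y i ω) ^ 2 - quadForm Sigma0 u with hZ
  have hXm : ∀ i, Measurable fun ω => u.ofLp ⬝ᵥ Y i ω := fun i => by
    simp only [dotProduct]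
    exact Finset.measurable_sum _ fun a _ => (measurable_pi_iff.1 (h.measurable i) a).const_mul _
  have hZm : ∀ i, Measurable (Z i) := fun i => ((hXm i).pow_const 2).sub_const _
  have hmgf : ∀ i (t : ℝ), |t| ≤ y → Integrable (fun ω => Real.exp (t * Z i ω)) P ∧
      mgf (Z i) P t ≤ Real.exp (8 * t ^ 2 / y ^ 2) := by
    intro i t ht
    have := mgf_sq_sub_integral_le (X := fun ω => u.ofLp ⬝ᵥ Y i ω) (μ := P) (K := K) (l := t)
      (hXm i).aemeasurable hK
      (fun q hq => h.eLpNorm_dotProduct_le hk hσ.le i u hu hq) (by rw [← hy]; exact ht)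
    rw [h.integral_sq_dotProduct hk hσ.le i u, ← hy] at this
    exact this
  have hind : iIndepFun Z P := by
    refine h.indep.comp (fun i (x : Fin p → ℝ) => (u.ofLp ⬝ᵥ x) ^ 2 - quadForm Sigma0 u) fun i => ?_
    have : Measurable fun x : Fin p → ℝ => u.ofLp ⬝ᵥ x := by
      simp only [dotProduct]
      exact Finset.measurable_sum _ fun a _ => (measurable_pi_apply a).const_mul _
    exact (this.pow_const 2).sub_const _
  have hsum : ∀ t : ℝ, |t| ≤ y →
      ∫⁻ ω, ENNReal.ofReal (Real.exp (t * ∑ i, Z i ω)) ∂P ≤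
        ENNReal.ofReal (Real.exp (8 * n * t ^ 2 / y ^ 2)) := by
    intro t ht
    have hi := hind.integrable_exp_mul_sum hZm (s := Finset.univ) (t := t)
      fun i _ => (hmgf i t ht).1
    have hm := hind.mgf_sum hZm (t := t) Finset.univ
    simp only [Finset.sum_apply] at hi
    rw [← ofReal_integral_eq_lintegral_ofReal hi (ae_of_all _ fun ω => (Real.exp_pos _).le)]
    apply ENNReal.ofReal_le_ofReal
    have e1 : ∫ ω, Real.exp (t * ∑ i, Z i ω) ∂P = mgf (∑ i, Z i) P t := by
      simp only [mgf, Finset.sum_apply]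
    rw [e1, hm]
    calc ∏ i, mgf (Z i) P t ≤ ∏ _i : Fin n, Real.exp (8 * t ^ 2 / y ^ 2) :=
          Finset.prod_le_prod (fun i _ => mgf_nonneg) fun i _ => (hmgf i t ht).2
      _ = _ := by
          rw [Finset.prod_const, Finset.card_univ, Fintype.card_fin, ← Real.exp_nat_mul]
          congr 1; ring
  have hn' : (n : ℝ) ≠ 0 := by exact_mod_cast hn.ne'
  have hq : ∀ ω, n * l * |quadForm (sampleCov (fun i => Y i ω) - Sigma0) u| =
      l * |∑ i, Z i ω| := by
    intro ω
    have : quadForm (sampleCov (fun i => Y i ω) - Sigma0) u = (n : ℝ)⁻¹ * ∑ i, Z i ω := by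
      rw [quadForm_sub, quadForm_sampleCov, hZ]
      simp only [Finset.sum_sub_distrib, Finset.sum_const, Finset.card_univ, Fintype.card_fin,
        nsmul_eq_mul]
      field_simp
    rw [this, abs_mul, abs_of_nonneg (by positivity : 0 ≤ (n : ℝ)⁻¹)]
    field_simp
  have habs : |l| ≤ y := by rwa [abs_of_nonneg hl0]
  simp_rw [hq]
  refine lintegral_exp_mul_abs_le (Finset.measurable_sum _ fun i _ => hZm i) l (hsum l habs)
    ((hsum (-l) (by rwa [abs_neg])).trans ?_)
  rw [neg_sq]

/-- Concentration of the sample covariance matrix at the rate `√(p / n)`. -/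
theorem IsTrueModel.measure_le_opNorm_sub_le [IsProbabilityMeasure P]
    (h : IsTrueModel P Y Sigma0 k σ₀) (hk : 0 < k) (hσ : 0 < σ₀) (hn : 0 < n) (hp : 0 < p)
    (hpn : p ≤ n) {y : ℝ} (hy : y = 1 / (24 * (σ₀ * (√(1 / k) * (5 / 4))) ^ 2)) (M : ℝ) :
    P {ω | M * √((p : ℝ) / n) ≤ opNorm (sampleCov (fun i => Y i ω) - Sigma0)} ≤
      ENNReal.ofReal (2 * Real.exp (p * (10 - y * M / 4))) := by
  have hy0 : 0 < y := by
    have := Real.sqrt_pos.2 (one_div_pos.2 hk)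
    rw [hy]; positivity
  have hn' : (0 : ℝ) < n := by exact_mod_cast hn
  have hr1 : √((p : ℝ) / n) ≤ 1 := by
    rw [Real.sqrt_le_one]
    rw [div_le_one hn']; exact_mod_cast hpn
  have hr0 : 0 ≤ √((p : ℝ) / n) := Real.sqrt_nonneg _
  have hr2 : √((p : ℝ) / n) ^ 2 = p / n := Real.sq_sqrt (by positivity)
  set r := √((p : ℝ) / n) with hr
  have hsym := h.wellConditioned.isSymm
  -- Take l = y√(p/n), which is admissible as p ≤ n. The moment bound contributes exp(8p), the
  -- factor 5^p at most exp(2p), and the threshold exp(−pyM/4).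
  refine (measure_le_opNorm_le hp P (A := fun ω => sampleCov (fun i => Y i ω) - Sigma0)
    (fun a b => (measurable_sampleCov_apply h.measurable a b).sub_const _)
    (fun ω => (isSymm_sampleCov _).sub hsym) (s := n * (y * r)) (by positivity)
    (b := 2 * Real.exp (8 * n * (y * r) ^ 2 / y ^ 2))
    (fun u hu => h.lintegral_exp_quadForm_le hk hσ hn hu hy (by positivity) (by nlinarith))
    (M * r)).trans (ENNReal.ofReal_le_ofReal ?_)
  have e1 : 8 * n * (y * r) ^ 2 / y ^ 2 = 8 * p := by
    rw [mul_pow, hr2]; field_simp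
  have e2 : n * (y * r) * (M * r / 4) = p * (y * M / 4) := by
    have : n * (y * r) * (M * r / 4) = n * r ^ 2 * (y * M / 4) := by ring
    rw [this, hr2]; field_simp
  have e3 := five_pow_le_exp p
  rw [e1, e2]
  calc _ ≤ Real.exp (2 * p) * (2 * Real.exp (8 * p)) * Real.exp (-(p * (y * M / 4))) := by gcongr
    _ = 2 * (Real.exp (2 * p) * Real.exp (8 * p) * Real.exp (-(p * (y * M / 4)))) := by ring
    _ = _ := by rw [← Real.exp_add, ← Real.exp_add]; ring_nf

end Model

/-! ### Half-vectorization coordinates. -/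

section SymmetricCoordinates
variable {p : ℕ}

theorem isSymm_symMat (t : VechIdx p → ℝ) : (symMat t).IsSymm := by
  ext i j
  simp only [symMat, transpose_apply, of_apply]
  rcases lt_trichotomy i j with h | h | h
  · rw [dif_pos h.le, dif_neg (not_le.2 h)]
  · subst h; rfl
  · rw [dif_neg (not_le.2 h), dif_pos h.le]

theorem vech_symMat (t : VechIdx p → ℝ) : vech (symMat t) = t := by
  ext ⟨⟨i, j⟩, h⟩
  simp only [vech, symMat, of_apply]
  exact dif_pos h

theorem symMat_vech {A : Matrix (Fin p) (Fin p) ℝ} (hA : A.IsSymm) : symMat (vech A) = A := by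
  ext i j
  simp only [symMat, vech, of_apply]
  split_ifs
  · rfl
  · exact hA.apply _ _

theorem symMat_add (s t : VechIdx p → ℝ) : symMat (s + t) = symMat s + symMat t := by
  ext i j
  simp only [symMat, of_apply, Matrix.add_apply]
  split_ifs <;> rfl

theorem symMat_smul (c : ℝ) (t : VechIdx p → ℝ) : symMat (c • t) = c • symMat t := by
  ext i j
  simp only [symMat, of_apply, Matrix.smul_apply]
  split_ifs <;> rfl

theorem symMat_neg (t : VechIdx p → ℝ) : symMat (-t) = -symMat t := by
  rw [← neg_one_smul ℝ t, symMat_smul, neg_one_smul]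

theorem continuous_symMat : Continuous (symMat : (VechIdx p → ℝ) → Matrix (Fin p) (Fin p) ℝ) := by
  refine continuous_matrix fun i j => ?_
  simp only [symMat, of_apply]
  split_ifs <;> exact continuous_apply _

/-- An off-diagonal column of `elimMat` has two entries 1/2, a diagonal column a single entry 1.
Halving the diagonal coordinates compensates for this. -/
theorem elimMat_mulVec {W : Matrix (Fin p) (Fin p) ℝ} (hW : W.IsSymm) :
    elimMat p *ᵥ (fun ij : VechIdx p => if ij.1.1 = ij.1.2 then W ij.1.1 ij.1.2 / 2
      else W ij.1.1 ij.1.2) = (1 / 2 : ℝ) • W.vec := by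
  ext ⟨a, b⟩
  simp only [mulVec, dotProduct, elimMat, of_apply, Pi.smul_apply, vec, smul_eq_mul]
  rcases lt_trichotomy a b with h | h | h
  · rw [Finset.sum_eq_single (⟨(b, a), h.le⟩ : VechIdx p)]
    · have h1 : b ≠ a := h.ne'
      simp [h1, h1.symm]
    · rintro ⟨⟨i, j⟩, hij⟩ - hne
      simp only [ne_eq, Subtype.mk.injEq, Prod.mk.injEq, not_and] at hne ⊢
      have hij' : j ≤ i := hij
      rw [if_neg, if_neg]
      · simp
      · rintro ⟨rfl, rfl⟩; exact absurd hij' (not_le.2 h)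
      · rintro ⟨rfl, rfl⟩; exact hne rfl rfl
    · simp
  · subst h
    rw [Finset.sum_eq_single (⟨(a, a), le_rfl⟩ : VechIdx p)]
    · simp; ring
    · rintro ⟨⟨i, j⟩, hij⟩ - hne
      simp only [ne_eq, Subtype.mk.injEq, Prod.mk.injEq, not_and] at hne ⊢
      rw [if_neg, if_neg]
      · simp
      · rintro ⟨rfl, rfl⟩; exact hne rfl rfl
      · rintro ⟨rfl, rfl⟩; exact hne rfl rfl
    · simp
  · rw [Finset.sum_eq_single (⟨(a, b), h.le⟩ : VechIdx p)]
    · have h1 : a ≠ b := h.ne'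
      simp [h1, hW.apply a b]
    · rintro ⟨⟨i, j⟩, hij⟩ - hne
      simp only [ne_eq, Subtype.mk.injEq, Prod.mk.injEq, not_and] at hne ⊢
      have hij' : j ≤ i := hij
      rw [if_neg, if_neg]
      · simp
      · rintro ⟨rfl, rfl⟩; exact hne rfl rfl
      · rintro ⟨rfl, rfl⟩; exact absurd hij' (not_le.2 h)
    · simp

end SymmetricCoordinates

/-! ### The covariance of the limit law and its inverse. -/

section LimitCovariance
variable {p : ℕ} {S : Matrix (Fin p) (Fin p) ℝ}

theorem isSymm_inv (hS : S.IsSymm) : S⁻¹.IsSymm := by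
  rw [Matrix.IsSymm, transpose_nonsing_inv, hS.eq]

theorem isSymm_conj_mul (hS : S.IsSymm) {X : Matrix (Fin p) (Fin p) ℝ} (hX : X.IsSymm) :
    (S * X * S).IsSymm := by
  rw [Matrix.IsSymm, transpose_mul, transpose_mul, hS.eq, hX.eq, Matrix.mul_assoc]

/-- An explicit preimage under `limitCov`, and its pairing with the argument. -/
theorem exists_limitCov_mulVec_eq (hS : S.PosDef) (x : VechIdx p → ℝ) :
    ∃ y, limitCov S *ᵥ y = x ∧ x ⬝ᵥ y = (S * symMat x * S * symMat x).trace / 2 := by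
  have hsym : S.IsSymm := isHermitian_iff_isSymm.1 hS.1
  have hdet : IsUnit S.det := hS.det_pos.ne'.isUnit
  set X := symMat x with hX
  have hXs : X.IsSymm := isSymm_symMat x
  have hW := isSymm_conj_mul hsym hXs
  have hy := elimMat_mulVec hW
  -- The half-vectorization of SXS with halved diagonal: `elimMat` sends it to vec(SXS)/2, the
  -- Kronecker product to vec(X)/2, the transpose to x/2, and the scalar 2 restores x.
  refine ⟨fun ij : VechIdx p => if ij.1.1 = ij.1.2 then (S * X * S) ij.1.1 ij.1.2 / 2
      else (S * X * S) ij.1.1 ij.1.2, ?_, ?_⟩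
  · rw [limitCov, smul_mulVec, ← mulVec_mulVec, ← mulVec_mulVec, hy, mulVec_smul,
      kronecker_mulVec_vec, (isSymm_inv hsym).eq]
    have : S⁻¹ * (S * X * S) * S⁻¹ = X := by
      rw [Matrix.mul_assoc S X S, ← Matrix.mul_assoc S⁻¹, nonsing_inv_mul _ hdet, Matrix.one_mul,
        Matrix.mul_assoc, mul_nonsing_inv _ hdet, Matrix.mul_one]
    rw [this, mulVec_smul, elimMat_transpose_mulVec_vec X hXs, hX, vech_symMat, smul_smul]
    norm_num
  · have h1 : x = (elimMat p)ᵀ *ᵥ X.vec := by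
      rw [elimMat_transpose_mulVec_vec X hXs, hX, vech_symMat]
    conv_lhs => rw [h1]
    rw [mulVec_transpose, ← dotProduct_mulVec, hy, dotProduct_smul, vec_dotProduct_vec, hXs.eq,
      trace_mul_comm, smul_eq_mul]
    ring

theorem isUnit_limitCov (hS : S.PosDef) : IsUnit (limitCov S) :=
  mulVec_surjective_iff_isUnit.1 fun x => (exists_limitCov_mulVec_eq hS x).imp fun _ h => h.1

theorem posDef_limitCov (hS : S.PosDef) : (limitCov S).PosDef := by
  have h1 : ((elimMat p)ᵀ * (S⁻¹ ⊗ₖ S⁻¹) * elimMat p).PosSemidef := by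
    have := (hS.inv.posSemidef.kronecker hS.inv.posSemidef).conjTranspose_mul_mul_same (elimMat p)
    rwa [conjTranspose_eq_transpose_of_trivial] at this
  have h2 : (limitCov S).PosSemidef := h1.smul (by norm_num)
  exact h2.posDef_iff_isUnit.2 (isUnit_limitCov hS)

/-- This replaces the inverse covariance by a trace, so that the normal exponent can be matched with
the likelihood expansion. -/
theorem dotProduct_inv_limitCov_mulVec (hS : S.PosDef) (x : VechIdx p → ℝ) :
    x ⬝ᵥ ((limitCov S)⁻¹ *ᵥ x) = (S * symMat x * S * symMat x).trace / 2 := by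
  obtain ⟨y, hy, h⟩ := exists_limitCov_mulVec_eq hS x
  have hdet : IsUnit (limitCov S).det := (isUnit_iff_isUnit_det _).1 (isUnit_limitCov hS)
  have : (limitCov S)⁻¹ *ᵥ x = y := by
    rw [← hy, mulVec_mulVec, nonsing_inv_mul _ hdet, one_mulVec]
  rw [this, h]

end LimitCovariance

/-! ### The Gaussian integral in several variables. -/

section GaussianIntegral

open scoped MatrixOrder in
theorem exists_eq_transpose_mul_self {ι : Type*} [Fintype ι] [DecidableEq ι] {C : Matrix ι ι ℝ}
    (hC : C.PosSemidef) : ∃ B : Matrix ι ι ℝ, C = Bᵀ * B := by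
  obtain ⟨B, hB⟩ := CStarAlgebra.nonneg_iff_eq_star_mul_self.1 hC.nonneg
  exact ⟨B, by rwa [star_eq_conjTranspose, conjTranspose_eq_transpose_of_trivial] at hB⟩

/-- Factor C = BᵀB and substitute x = Bᵀz: as BC⁻¹Bᵀ = 1 the integrand becomes a product of
one-dimensional Gaussians, and the Jacobian is |det B| = √(det C). -/
theorem integral_exp_neg_inv_quadratic {ι : Type*} [Fintype ι] [DecidableEq ι] {C : Matrix ι ι ℝ}
    (hC : C.PosDef) :
    ∫ x : ι → ℝ, Real.exp (-(x ⬝ᵥ (C⁻¹ *ᵥ x)) / 2) =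
      √((2 * Real.pi) ^ Fintype.card ι * C.det) := by
  obtain ⟨B, hB⟩ := exists_eq_transpose_mul_self hC.posSemidef
  have hdet2 : C.det = B.det ^ 2 := by rw [hB, det_mul, det_transpose, sq]
  have hBdet : B.det ≠ 0 := fun h => hC.det_pos.ne' (by rw [hdet2, h]; norm_num)
  have hBu : IsUnit B.det := hBdet.isUnit
  have hBtu : IsUnit Bᵀ.det := by rwa [det_transpose]
  have hmap := Real.map_matrix_volume_pi_eq_smul_volume_pi (M := Bᵀ) (by rwa [det_transpose])
  have hcont : Continuous fun x : ι → ℝ => Real.exp (-(x ⬝ᵥ (C⁻¹ *ᵥ x)) / 2) := by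
    simp only [dotProduct, mulVec]; fun_prop
  have hq : ∀ z : ι → ℝ, (Bᵀ *ᵥ z) ⬝ᵥ (C⁻¹ *ᵥ (Bᵀ *ᵥ z)) = ∑ i, z i ^ 2 := by
    intro z
    have : B * C⁻¹ * Bᵀ = 1 := by
      rw [hB, Matrix.mul_inv_rev, Matrix.mul_assoc, Matrix.mul_assoc, nonsing_inv_mul _ hBtu, Matrix.mul_one,
        mul_nonsing_inv _ hBu]
    rw [mulVec_transpose, ← dotProduct_mulVec, ← mulVec_transpose, mulVec_mulVec, mulVec_mulVec,
      this, one_mulVec]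
    simp [dotProduct, sq]
  have h1 : ∫ z : ι → ℝ, Real.exp (-((Bᵀ *ᵥ z) ⬝ᵥ (C⁻¹ *ᵥ (Bᵀ *ᵥ z))) / 2) =
      |B.det|⁻¹ * ∫ x : ι → ℝ, Real.exp (-(x ⬝ᵥ (C⁻¹ *ᵥ x)) / 2) := by
    have h2 := integral_map (μ := volume) (φ := toLin' Bᵀ)
      (f := fun x : ι → ℝ => Real.exp (-(x ⬝ᵥ (C⁻¹ *ᵥ x)) / 2))
      (LinearMap.continuous_of_finiteDimensional _).aemeasurable hcont.aestronglyMeasurable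
    rw [hmap, integral_smul_measure, det_transpose] at h2
    simp only [toLin'_apply] at h2
    rw [← h2, ENNReal.toReal_ofReal (abs_nonneg _), abs_inv, smul_eq_mul]
  have h3 : ∫ z : ι → ℝ, Real.exp (-((Bᵀ *ᵥ z) ⬝ᵥ (C⁻¹ *ᵥ (Bᵀ *ᵥ z))) / 2) =
      √((2 * Real.pi) ^ Fintype.card ι) := by
    have h4 : ∀ z : ι → ℝ, Real.exp (-((Bᵀ *ᵥ z) ⬝ᵥ (C⁻¹ *ᵥ (Bᵀ *ᵥ z))) / 2) =
        ∏ i, Real.exp (-(1 / 2) * z i ^ 2) := by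
      intro z
      rw [hq, ← Real.exp_sum, ← Finset.mul_sum]; congr 1; ring
    simp_rw [h4]
    rw [integral_fintype_prod_volume_eq_pow fun x : ℝ => Real.exp (-(1 / 2) * x ^ 2),
      integral_gaussian, show Real.pi / (1 / 2) = 2 * Real.pi by ring]
    have h5 : (√(2 * Real.pi) ^ Fintype.card ι) ^ 2 = (2 * Real.pi) ^ Fintype.card ι := by
      rw [← pow_mul, mul_comm (Fintype.card ι), pow_mul, Real.sq_sqrt (by positivity)]
    rw [← h5, Real.sqrt_sq (by positivity)]
  rw [h3] at h1
  have hB0 : |B.det| ≠ 0 := abs_ne_zero.2 hBdet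
  rw [Real.sqrt_mul (by positivity), hdet2, Real.sqrt_sq_eq_abs, h1]
  field_simp

end GaussianIntegral

/-! ### The limit density, its exponential moments and its tail. -/

section LimitDensity
variable {p : ℕ} {S : Matrix (Fin p) (Fin p) ℝ}

/-- The quadratic form `tr (S T S T)` of the limiting normal law. -/
def traceForm (S : Matrix (Fin p) (Fin p) ℝ) (t : VechIdx p → ℝ) : ℝ :=
  (S * symMat t * S * symMat t).trace

/-- Normalizing constant of the limiting normal law. -/
def limitConst (S : Matrix (Fin p) (Fin p) ℝ) : ℝ :=
  √((2 * Real.pi) ^ Fintype.card (VechIdx p) * (limitCov S).det)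

theorem continuous_traceForm : Continuous (traceForm S) := by
  have := continuous_symMat (p := p)
  unfold traceForm
  fun_prop

theorem limitConst_pos (hS : S.PosDef) : 0 < limitConst S :=
  Real.sqrt_pos.2 (mul_pos (by positivity) (posDef_limitCov hS).det_pos)

theorem smnDensity_eq (hS : S.PosDef) (t : VechIdx p → ℝ) :
    smnDensity 0 (limitCov S) (symMat t) = Real.exp (-traceForm S t / 4) / limitConst S := by
  have h0 : vech (symMat t) - vech (0 : Matrix (Fin p) (Fin p) ℝ) = t := by
    rw [vech_symMat]; ext; simp [vech]
  rw [smnDensity, h0, dotProduct_inv_limitCov_mulVec hS, limitConst, traceForm]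
  congr 2; ring

theorem integral_exp_traceForm (hS : S.PosDef) :
    ∫ t, Real.exp (-traceForm S t / 4) = limitConst S := by
  rw [limitConst, ← integral_exp_neg_inv_quadratic (posDef_limitCov hS)]
  refine integral_congr_ae (ae_of_all _ fun t => ?_)
  simp only [dotProduct_inv_limitCov_mulVec hS, traceForm]
  congr 1; ring

theorem integrable_exp_traceForm (hS : S.PosDef) :
    Integrable fun t => Real.exp (-traceForm S t / 4) := by
  -- A function that is not integrable has integral 0 by convention, whereas this integral is
  -- already known to be positive.
  by_contra h
  have := integral_exp_traceForm hS
  rw [integral_undef h] at this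
  exact (limitConst_pos hS).ne this

theorem measurable_smnDensity (hS : S.PosDef) :
    Measurable fun t => smnDensity 0 (limitCov S) (symMat t) := by
  simp_rw [smnDensity_eq hS]
  exact ((Real.continuous_exp.comp (continuous_traceForm.neg.div_const 4)).div_const _).measurable

theorem smnDensity_nonneg (hS : S.PosDef) (t : VechIdx p → ℝ) :
    0 ≤ smnDensity 0 (limitCov S) (symMat t) := by
  rw [smnDensity_eq hS]
  exact div_nonneg (Real.exp_pos _).le (limitConst_pos hS).le

theorem lintegral_smnDensity (hS : S.PosDef) :
    ∫⁻ t, ENNReal.ofReal (smnDensity 0 (limitCov S) (symMat t)) = 1 := by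
  have hi : Integrable fun t => smnDensity 0 (limitCov S) (symMat t) := by
    simp_rw [smnDensity_eq hS]
    exact (integrable_exp_traceForm hS).div_const _
  rw [← ofReal_integral_eq_lintegral_ofReal hi (ae_of_all _ (smnDensity_nonneg hS))]
  simp_rw [smnDensity_eq hS]
  rw [integral_div, integral_exp_traceForm hS, div_self (limitConst_pos hS).ne', ENNReal.ofReal_one]

/-- Completing the square: the shift W = 2aS⁻¹uuᵀS⁻¹ is chosen so that tr(STSW) = 2a uᵀTu. -/
theorem traceForm_sub (hS : S.PosDef) (t : VechIdx p → ℝ) (u : EuclideanSpace ℝ (Fin p)) (a : ℝ) :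
    traceForm S (t - vech ((2 * a) • (S⁻¹ * vecMulVec u.ofLp u.ofLp * S⁻¹))) =
      traceForm S t - 4 * a * quadForm (symMat t) u + 4 * a ^ 2 * quadForm S⁻¹ u ^ 2 := by
  have hsym : S.IsSymm := isHermitian_iff_isSymm.1 hS.1
  have hdet : IsUnit S.det := hS.det_pos.ne'.isUnit
  set U := vecMulVec u.ofLp u.ofLp with hU
  have hUs : U.IsSymm := by ext i j; simp [hU, vecMulVec_apply, mul_comm]
  set V := S⁻¹ * U * S⁻¹ with hV
  have hVs : V.IsSymm := isSymm_conj_mul (isSymm_inv hsym) hUs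
  have hW : symMat (vech ((2 * a) • V)) = (2 * a) • V :=
    symMat_vech (by rw [Matrix.IsSymm, transpose_smul, hVs.eq])
  have htr : ∀ A : Matrix (Fin p) (Fin p) ℝ, (A * U).trace = quadForm A u := by
    intro A
    rw [hU, mul_vecMulVec, trace_vecMulVec, quadForm, dotProduct_comm]
  have hSV : S * V = U * S⁻¹ := by
    rw [hV, Matrix.mul_assoc S⁻¹, ← Matrix.mul_assoc, mul_nonsing_inv _ hdet, Matrix.one_mul]
  set T := symMat t with hT
  have e1 : (S * T * S * V).trace = quadForm T u := by
    rw [Matrix.mul_assoc (S * T), hSV, trace_mul_comm, Matrix.mul_assoc, ← Matrix.mul_assoc S⁻¹,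
      nonsing_inv_mul _ hdet, Matrix.one_mul, trace_mul_comm, htr]
  have e2 : (S * V * S * T).trace = quadForm T u := by
    rw [← e1, Matrix.mul_assoc, trace_mul_comm, ← Matrix.mul_assoc]
  have e3 : (S * V * S * V).trace = quadForm S⁻¹ u ^ 2 := by
    have : U * S⁻¹ * U = quadForm S⁻¹ u • U := by
      rw [hU, vecMulVec_mul, vecMulVec_mul_vecMulVec, quadForm, ← dotProduct_mulVec]
      ext i j
      simp [vecMulVec_apply]; ring
    rw [Matrix.mul_assoc, hSV, ← Matrix.mul_assoc (U * S⁻¹), this,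
      smul_mul, trace_smul, trace_mul_comm, htr, smul_eq_mul, sq]
  have hsub : symMat (t - vech ((2 * a) • V)) = T - (2 * a) • V := by
    rw [sub_eq_add_neg, symMat_add, symMat_neg, hW, sub_eq_add_neg]
  rw [traceForm, hsub, traceForm, ← hT]
  simp only [Matrix.mul_sub, Matrix.sub_mul, Matrix.mul_smul, Matrix.smul_mul, trace_sub,
    trace_smul, smul_eq_mul, e1, e2, e3]
  ring

/-- After completing the square, the tilted density is a constant times a translate of the density,
and translation preserves its mass 1. -/
theorem lintegral_smnDensity_mul_exp (hS : S.PosDef) (u : EuclideanSpace ℝ (Fin p)) (a : ℝ) :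
    ∫⁻ t, ENNReal.ofReal (smnDensity 0 (limitCov S) (symMat t)) *
      ENNReal.ofReal (Real.exp (a * quadForm (symMat t) u)) =
        ENNReal.ofReal (Real.exp (a ^ 2 * quadForm S⁻¹ u ^ 2)) := by
  set w := vech ((2 * a) • (S⁻¹ * vecMulVec u.ofLp u.ofLp * S⁻¹)) with hw
  have h1 : ∀ t, ENNReal.ofReal (smnDensity 0 (limitCov S) (symMat t)) *
      ENNReal.ofReal (Real.exp (a * quadForm (symMat t) u)) =
      ENNReal.ofReal (Real.exp (a ^ 2 * quadForm S⁻¹ u ^ 2)) *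
        ENNReal.ofReal (smnDensity 0 (limitCov S) (symMat (t - w))) := by
    intro t
    rw [← ENNReal.ofReal_mul (smnDensity_nonneg hS t), ← ENNReal.ofReal_mul (Real.exp_pos _).le,
      smnDensity_eq hS, smnDensity_eq hS, hw, traceForm_sub hS, div_mul_eq_mul_div,
      mul_div_assoc', ← Real.exp_add, ← Real.exp_add]
    congr 3; ring
  simp_rw [h1]
  rw [lintegral_const_mul' _ _ ENNReal.ofReal_ne_top, lintegral_sub_right_eq_self
    (fun t => ENNReal.ofReal (smnDensity 0 (limitCov S) (symMat t))) w, lintegral_smnDensity hS,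
    mul_one]

/-- Tail of the spectral norm under the limiting normal law. -/
theorem lintegral_smnDensity_tail_le (hp : 0 < p) (hS : S.PosDef) {c : ℝ}
    (hc : opNorm S⁻¹ ≤ c) (M : ℝ) :
    ∫⁻ t in {t | M * √(p : ℝ) ≤ opNorm (symMat t)},
      ENNReal.ofReal (smnDensity 0 (limitCov S) (symMat t)) ≤
        ENNReal.ofReal (2 * Real.exp (p * (2 + (25 / 16 * c) ^ 2 - M / 4))) := by
  set μ : Measure (VechIdx p → ℝ) := volume.withDensity fun t =>
    ENNReal.ofReal (smnDensity 0 (limitCov S) (symMat t)) with hμ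
  have hm := (measurable_smnDensity hS).ennreal_ofReal
  have hprob : IsProbabilityMeasure μ := ⟨by
    rw [hμ, withDensity_apply _ MeasurableSet.univ, setLIntegral_univ, lintegral_smnDensity hS]⟩
  have hc0 : 0 ≤ c := (opNorm_nonneg _).trans hc
  have hent : ∀ i j, Measurable fun t : VechIdx p → ℝ => symMat t i j := fun i j =>
    (continuous_symMat.matrix_elem i j).measurable
  have hqm : ∀ u, Measurable fun t : VechIdx p → ℝ => quadForm (symMat t) u := fun u => by
    simp only [quadForm, dotProduct, mulVec]
    exact Finset.measurable_sum _ fun i _ => (Finset.measurable_sum _ fun j _ =>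
      (hent i j).mul_const _).const_mul _
  have hexp : ∀ u a, ∫⁻ t, ENNReal.ofReal (Real.exp (a * quadForm (symMat t) u)) ∂μ =
      ENNReal.ofReal (Real.exp (a ^ 2 * quadForm S⁻¹ u ^ 2)) := by
    intro u a
    have hg : Measurable fun t : VechIdx p → ℝ =>
        ENNReal.ofReal (Real.exp (a * quadForm (symMat t) u)) :=
      (Real.measurable_exp.comp ((hqm u).const_mul a)).ennreal_ofReal
    rw [← lintegral_smnDensity_mul_exp hS u a, hμ,
      lintegral_withDensity_eq_lintegral_mul _ hm hg]
    rfl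
  -- Rate √p balances both effects: the moments cost exp(O(p)), and the threshold M√p gains
  -- exp(−pM/4). The factor 25/16 is (5/4)².
  have hB : ∀ u : EuclideanSpace ℝ (Fin p), ‖u‖ ≤ 5 / 4 →
      ∫⁻ t, ENNReal.ofReal (Real.exp (√(p : ℝ) * |quadForm (symMat t) u|)) ∂μ ≤
        ENNReal.ofReal (2 * Real.exp (p * (25 / 16 * c) ^ 2)) := by
    intro u hu
    have h1 : ∀ a : ℝ, a ^ 2 = p → ∫⁻ t, ENNReal.ofReal (Real.exp (a * quadForm (symMat t) u)) ∂μ ≤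
        ENNReal.ofReal (Real.exp (p * (25 / 16 * c) ^ 2)) := by
      intro a ha
      rw [hexp, ha]
      apply ENNReal.ofReal_le_ofReal
      have h2 : |quadForm S⁻¹ u| ≤ 25 / 16 * c := by
        refine (abs_quadForm_le _ _).trans ?_
        have h3 : ‖u‖ ^ 2 ≤ 25 / 16 := by nlinarith [norm_nonneg u]
        calc _ ≤ c * (25 / 16) := by gcongr
          _ = _ := mul_comm _ _
      have h4 : quadForm S⁻¹ u ^ 2 ≤ (25 / 16 * c) ^ 2 := by
        rw [← sq_abs]; gcongr
      gcongr
    have hsq : √(p : ℝ) ^ 2 = p := Real.sq_sqrt (Nat.cast_nonneg p)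
    exact lintegral_exp_mul_abs_le (hqm u) _ (h1 _ hsq) (h1 _ (by rw [neg_sq, hsq]))
  have h := measure_le_opNorm_le hp μ hent (fun t => isSymm_symMat t) (Real.sqrt_nonneg p) hB
    (M * √(p : ℝ))
  have hset : MeasurableSet {t : VechIdx p → ℝ | M * √(p : ℝ) ≤ opNorm (symMat t)} :=
    measurableSet_le measurable_const (measurable_opNorm_comp hent)
  rw [hμ, withDensity_apply _ hset] at h
  refine h.trans (ENNReal.ofReal_le_ofReal ?_)
  have e3 := five_pow_le_exp p
  have e4 : √(p : ℝ) * (M * √(p : ℝ) / 4) = p * (M / 4) := by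
    have hsq : √(p : ℝ) ^ 2 = p := Real.sq_sqrt (Nat.cast_nonneg p)
    nth_rewrite 3 [← hsq]; ring
  rw [e4]
  calc _ ≤ Real.exp (2 * p) * (2 * Real.exp (p * (25 / 16 * c) ^ 2)) *
        Real.exp (-(p * (M / 4))) := by gcongr
    _ = 2 * (Real.exp (2 * p) * Real.exp (p * (25 / 16 * c) ^ 2) * Real.exp (-(p * (M / 4)))) := by
        ring
    _ = _ := by rw [← Real.exp_add, ← Real.exp_add]; ring_nf

end LimitDensity

/-! ### Eigenvalues of T relative to S⁻¹. -/

section Spectrum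
variable {p : ℕ} {S T : Matrix (Fin p) (Fin p) ℝ}

theorem det_one_add_smul_eq_prod {H : Matrix (Fin p) (Fin p) ℝ} (hH : H.IsHermitian) (c : ℝ) :
    (1 + c • H).det = ∏ i, (1 + c * hH.eigenvalues i) := by
  have h : 1 + c • H = Unitary.conjStarAlgAut ℝ _ hH.eigenvectorUnitary
      (diagonal fun i => 1 + c * hH.eigenvalues i) := by
    have h1 : (diagonal fun i => 1 + c * hH.eigenvalues i : Matrix (Fin p) (Fin p) ℝ) =
        1 + c • diagonal (RCLike.ofReal ∘ hH.eigenvalues) := by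
      ext i j
      rcases eq_or_ne i j with rfl | hij
      · simp
      · simp [hij]
    rw [h1, map_add, map_one, map_smul, ← hH.spectral_theorem]
  rw [h, Unitary.conjStarAlgAut_apply, det_mul_right_comm,
    Unitary.mul_star_self_of_mem hH.eigenvectorUnitary.2, Matrix.one_mul, det_diagonal]

theorem trace_mul_self_eq_sum {H : Matrix (Fin p) (Fin p) ℝ} (hH : H.IsHermitian) :
    (H * H).trace = ∑ i, hH.eigenvalues i ^ 2 := by
  have h : H * H = Unitary.conjStarAlgAut ℝ _ hH.eigenvectorUnitary
      (diagonal fun i => hH.eigenvalues i ^ 2) := by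
    have h1 : (diagonal fun i => hH.eigenvalues i ^ 2 : Matrix (Fin p) (Fin p) ℝ) =
        diagonal (RCLike.ofReal ∘ hH.eigenvalues) * diagonal (RCLike.ofReal ∘ hH.eigenvalues) := by
      rw [diagonal_mul_diagonal]
      congr 1; ext i; simp [sq]
    rw [h1, map_mul, ← hH.spectral_theorem]
  rw [h, Unitary.conjStarAlgAut_apply, trace_mul_comm, ← Matrix.mul_assoc]
  simp [trace_diagonal]

/-- The eigenvalues of `B T Bᵀ`, where `S = Bᵀ B`, describe `T` relative to `S⁻¹`. -/
theorem exists_relative_eigenvalues (hS : S.PosDef) (hT : T.IsSymm) :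
    ∃ l : Fin p → ℝ, (T * S).trace = ∑ i, l i ∧ (S * T * S * T).trace = ∑ i, l i ^ 2 ∧
      (∀ i, |l i| ≤ opNorm S * opNorm T) ∧
      (∀ c : ℝ, (S⁻¹ + c • T).det = S⁻¹.det * ∏ i, (1 + c * l i)) ∧
      ∀ c : ℝ, (S⁻¹ + c • T).PosDef → ∀ i, 0 < 1 + c * l i := by
  obtain ⟨B, hB⟩ := exists_eq_transpose_mul_self hS.posSemidef
  have hdet2 : S.det = B.det ^ 2 := by rw [hB, det_mul, det_transpose, sq]
  have hBdet : B.det ≠ 0 := fun h => hS.det_pos.ne' (by rw [hdet2, h]; norm_num)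
  have hBu : IsUnit B.det := hBdet.isUnit
  have hBtu : IsUnit Bᵀ.det := by rwa [det_transpose]
  have hHs : (B * T * Bᵀ).IsSymm := by
    rw [Matrix.IsSymm, transpose_mul, transpose_mul, transpose_transpose, hT.eq, Matrix.mul_assoc]
  have hH := isHermitian_iff_isSymm.2 hHs
  have hinv : B * S⁻¹ * Bᵀ = 1 := by
    rw [hB, Matrix.mul_inv_rev, Matrix.mul_assoc, Matrix.mul_assoc, nonsing_inv_mul _ hBtu,
      Matrix.mul_one, mul_nonsing_inv _ hBu]
  -- Congruence by B turns S⁻¹ into the identity, so determinant and positivity of S⁻¹ + cT can be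
  -- read off the eigenvalues of BTBᵀ.
  have hconj : ∀ c : ℝ, B * (S⁻¹ + c • T) * Bᵀ = 1 + c • (B * T * Bᵀ) := by
    intro c
    rw [Matrix.mul_add, Matrix.add_mul, hinv, Matrix.mul_smul, Matrix.smul_mul]
  have hev := fun i => hH.mulVec_eigenvectorBasis i
  have hn : ∀ i, ‖hH.eigenvectorBasis i‖ = 1 := fun i => hH.eigenvectorBasis.orthonormal.1 i
  have hqf : ∀ i, quadForm (B * T * Bᵀ) (hH.eigenvectorBasis i) = hH.eigenvalues i := by
    intro i
    rw [quadForm_of_mulVec_eq (hev i), hn]; ring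
  refine ⟨hH.eigenvalues, ?_, ?_, fun i => ?_, fun c => ?_, fun c hc i => ?_⟩
  · have := hH.trace_eq_sum_eigenvalues
    simp only [RCLike.ofReal_real_eq_id, id_eq] at this
    rw [← this, hB, ← Matrix.mul_assoc, trace_mul_comm, ← Matrix.mul_assoc]
  · rw [← trace_mul_self_eq_sum hH, hB]
    simp only [Matrix.mul_assoc]
    rw [trace_mul_comm]
    simp only [Matrix.mul_assoc]
  · rw [← hqf i]
    refine (abs_quadForm_le _ _).trans ?_
    rw [hn, one_pow, mul_one]
    calc opNorm (B * T * Bᵀ) ≤ opNorm B * opNorm T * opNorm Bᵀ :=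
          (opNorm_mul_le _ _).trans (mul_le_mul_of_nonneg_right (opNorm_mul_le _ _)
            (opNorm_nonneg _))
      _ = _ := by rw [opNorm_transpose, hB, opNorm_transpose_mul_self]; ring
  · have h1 := congrArg Matrix.det (hconj c)
    rw [det_one_add_smul_eq_prod hH, det_mul, det_mul, det_transpose] at h1
    rw [← h1, det_nonsing_inv, Ring.inverse_eq_inv', hdet2]
    field_simp
  · have h1 : 0 < quadForm (B * (S⁻¹ + c • T) * Bᵀ) (hH.eigenvectorBasis i) := by
      rw [quadForm, ← mulVec_mulVec, ← mulVec_mulVec, dotProduct_mulVec, ← mulVec_transpose]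
      have h2 : Bᵀ *ᵥ (hH.eigenvectorBasis i).ofLp ≠ 0 := by
        intro h0
        have h3 : (hH.eigenvectorBasis i).ofLp = 0 := by
          rw [← one_mulVec (hH.eigenvectorBasis i).ofLp, ← nonsing_inv_mul _ hBtu,
            ← mulVec_mulVec, h0, mulVec_zero]
        have h4 := dotProduct_self_eq_norm_sq (hH.eigenvectorBasis i)
        rw [h3, hn] at h4
        simp at h4
      simpa using hc.dotProduct_mulVec_pos h2
    rw [hconj, quadForm_add, quadForm_smul, hqf] at h1
    have h5 : quadForm (1 : Matrix (Fin p) (Fin p) ℝ) (hH.eigenvectorBasis i) = 1 := by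
      rw [quadForm, one_mulVec, dotProduct_self_eq_norm_sq, hn, one_pow]
    rwa [h5] at h1

/-- With S = BᵀB and z = BS⁻¹u one has u = Bᵀz, uᵀS⁻¹u = ‖z‖² and ‖B‖² = ‖S‖. -/
theorem le_quadForm_inv (hS : S.PosDef) {c : ℝ} (hc : 0 < c) (h : opNorm S ≤ c)
    (u : EuclideanSpace ℝ (Fin p)) : 1 / c * ‖u‖ ^ 2 ≤ quadForm S⁻¹ u := by
  obtain ⟨B, hB⟩ := exists_eq_transpose_mul_self hS.posSemidef
  have hdet : IsUnit S.det := hS.det_pos.ne'.isUnit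
  set z : EuclideanSpace ℝ (Fin p) := WithLp.toLp 2 (B *ᵥ (S⁻¹ *ᵥ u.ofLp)) with hz
  have hu : Bᵀ *ᵥ z.ofLp = u.ofLp := by
    simp only [hz]
    rw [mulVec_mulVec, mulVec_mulVec, ← hB, mul_nonsing_inv _ hdet, one_mulVec]
  have h1 : quadForm S⁻¹ u = ‖z‖ ^ 2 := by
    have h2 : u.ofLp ⬝ᵥ (S⁻¹ *ᵥ u.ofLp) = z.ofLp ⬝ᵥ z.ofLp := by
      nth_rewrite 1 [← hu]
      rw [mulVec_transpose, ← dotProduct_mulVec]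
    rw [quadForm, h2, dotProduct_self_eq_norm_sq]
  have h3 : ‖u‖ ≤ opNorm B * ‖z‖ := by
    have := norm_toLp_mulVec_le Bᵀ z
    rwa [hu, opNorm_transpose] at this
  have h4 : opNorm B * opNorm B ≤ c := by rw [← opNorm_transpose_mul_self, ← hB]; exact h
  have h5 : ‖u‖ ^ 2 ≤ c * ‖z‖ ^ 2 := by
    calc ‖u‖ ^ 2 ≤ (opNorm B * ‖z‖) ^ 2 := by gcongr
      _ = opNorm B * opNorm B * ‖z‖ ^ 2 := by ring
      _ ≤ _ := by gcongr
  rw [h1, one_div, inv_mul_le_iff₀ hc]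
  exact h5

end Spectrum

/-! ### The likelihood ratio and its quadratic expansion. -/

section Likelihood
variable {n p : ℕ} {S : Matrix (Fin p) (Fin p) ℝ}

theorem isSymm_precOf (hS : S.IsSymm) (t : VechIdx p → ℝ) : (precOf n S t).IsSymm :=
  (isSymm_inv hS).add (by rw [Matrix.IsSymm, transpose_smul, (isSymm_symMat t).eq])

/-- The least eigenvalue of S⁻¹ is at least 1/c, and the perturbation T/√n has norm at most ρ ≤
1/(2c). -/
theorem mem_localSet_of_opNorm_le (hn : 0 < n) (hS : S.PosDef) {c ρ : ℝ} (hc : 0 < c)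
    (h : opNorm S ≤ c) (hρ : c * ρ ≤ 1 / 2) {t : VechIdx p → ℝ}
    (ht : opNorm (symMat t) ≤ √(n : ℝ) * ρ) : t ∈ localSet n S := by
  have hn' : 0 < √(n : ℝ) := Real.sqrt_pos.2 (by exact_mod_cast hn)
  refine posDef_of_le_quadForm (k := 1 / c - ρ) (isSymm_precOf (isHermitian_iff_isSymm.1 hS.1) t) ?_
    fun u => ?_
  · rw [sub_pos, lt_div_iff₀ hc]; linarith
  · rw [precOf, quadForm_add, quadForm_smul]
    have h1 := le_quadForm_inv hS hc h u
    have h2 : |(√(n : ℝ))⁻¹ * quadForm (symMat t) u| ≤ ρ * ‖u‖ ^ 2 := by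
      rw [abs_mul, abs_inv, abs_of_pos hn', inv_mul_le_iff₀ hn', ← mul_assoc]
      exact (abs_quadForm_le _ _).trans (by gcongr)
    have := (abs_le.1 h2).1
    linarith

/-- Spectral form of the likelihood ratio. -/
theorem exists_log_likRatio_eq (hS : S.PosDef) {t : VechIdx p → ℝ}
    (ht : t ∈ localSet n S) :
    ∃ l : Fin p → ℝ, traceForm S t = ∑ i, l i ^ 2 ∧ (∀ i, |l i| ≤ opNorm S * opNorm (symMat t)) ∧
      (∀ i, 0 < 1 + (√(n : ℝ))⁻¹ * l i) ∧
      likRatio n S t = Real.exp (n / 2 * ∑ i, (Real.log (1 + (√(n : ℝ))⁻¹ * l i) -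
        (√(n : ℝ))⁻¹ * l i)) := by
  obtain ⟨l, htr, hsq, hle, hdet, hpos⟩ := exists_relative_eigenvalues hS (isSymm_symMat t)
  have hpos' := hpos _ ht
  refine ⟨l, hsq, hle, hpos', ?_⟩
  rw [likRatio, Set.indicator_of_mem ht, logLik, logLik]
  congr 1
  have h1 : Real.log (precOf n S t).det = Real.log S⁻¹.det +
      ∑ i, Real.log (1 + (√(n : ℝ))⁻¹ * l i) := by
    rw [precOf, hdet, Real.log_mul hS.inv.det_pos.ne' (Finset.prod_pos fun i _ => hpos' i).ne',
      Real.log_prod fun i _ => (hpos' i).ne']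
  have h2 : (precOf n S t * S).trace = (S⁻¹ * S).trace + (√(n : ℝ))⁻¹ * ∑ i, l i := by
    rw [precOf, Matrix.add_mul, trace_add, Matrix.smul_mul, trace_smul, htr, smul_eq_mul]
  rw [h1, h2, Finset.sum_sub_distrib, ← Finset.mul_sum]
  ring

theorem likRatio_nonneg (t : VechIdx p → ℝ) : 0 ≤ likRatio n S t :=
  Set.indicator_nonneg (fun _ _ => (Real.exp_pos _).le) t

theorem likRatio_pos {t : VechIdx p → ℝ} (ht : t ∈ localSet n S) : 0 < likRatio n S t := by
  rw [likRatio, Set.indicator_of_mem ht]; exact Real.exp_pos _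

/-- Each summand obeys log(1 + x) ≤ x. This bound makes the posterior normalizer finite. -/
theorem likRatio_le_one (hS : S.PosDef) (t : VechIdx p → ℝ) : likRatio n S t ≤ 1 := by
  by_cases ht : t ∈ localSet n S
  · obtain ⟨l, -, -, hpos, h⟩ := exists_log_likRatio_eq hS ht
    rw [h, Real.exp_le_one_iff]
    refine mul_nonpos_of_nonneg_of_nonpos (by positivity) (Finset.sum_nonpos fun i _ => ?_)
    have := Real.log_le_sub_one_of_pos (hpos i)
    linarith
  · rw [likRatio, Set.indicator_of_notMem ht]; exact zero_le_one

/-- The logarithmic series at −x, cut after two terms, has remainder at most |x|³/(1 − |x|). -/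
theorem abs_log_one_add_sub_le {x : ℝ} (hx : |x| ≤ 1 / 2) :
    |Real.log (1 + x) - x + x ^ 2 / 2| ≤ 2 * |x| ^ 3 := by
  have h := Real.abs_log_sub_add_sum_range_le (x := -x) (by rw [abs_neg]; linarith) 2
  simp only [Finset.sum_range_succ, Finset.sum_range_zero, abs_neg, sub_neg_eq_add] at h
  have h1 : |x| ^ (2 + 1) / (1 - |x|) ≤ 2 * |x| ^ 3 := by
    rw [div_le_iff₀ (by linarith)]
    have := mul_le_mul_of_nonneg_left hx (pow_nonneg (abs_nonneg x) 3)
    rw [show 2 + 1 = 3 from rfl]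
    linarith
  refine le_trans (le_of_eq ?_) (h.trans h1)
  congr 1
  norm_num
  ring

/-- Quadratic expansion of the likelihood ratio. -/
theorem exists_likRatio_eq_exp_mul (hn : 0 < n) (hS : S.PosDef) {c ρ : ℝ} (hc : 0 < c)
    (h : opNorm S ≤ c) (hρ : c * ρ ≤ 1 / 2) {t : VechIdx p → ℝ}
    (ht : opNorm (symMat t) ≤ √(n : ℝ) * ρ) :
    ∃ d : ℝ, |d| ≤ n * p * (c * ρ) ^ 3 ∧
      likRatio n S t = Real.exp d * Real.exp (-traceForm S t / 4) := by
  obtain ⟨l, hsq, hle, hpos, hl⟩ :=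
    exists_log_likRatio_eq hS (mem_localSet_of_opNorm_le hn hS hc h hρ ht)
  have hn0 : (0 : ℝ) < n := by exact_mod_cast hn
  have hn' : 0 < √(n : ℝ) := Real.sqrt_pos.2 hn0
  set x : Fin p → ℝ := fun i => (√(n : ℝ))⁻¹ * l i with hx
  have hxle : ∀ i, |x i| ≤ c * ρ := by
    intro i
    rw [hx, abs_mul, abs_inv, abs_of_pos hn', inv_mul_le_iff₀ hn']
    calc |l i| ≤ opNorm S * opNorm (symMat t) := hle i
      _ ≤ c * (√(n : ℝ) * ρ) := mul_le_mul h ht (opNorm_nonneg _) hc.le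
      _ = _ := by ring
  have hxsq : n / 2 * ∑ i, x i ^ 2 / 2 = traceForm S t / 4 := by
    have : ∀ i, x i ^ 2 / 2 = (n : ℝ)⁻¹ / 2 * l i ^ 2 := by
      intro i
      rw [hx, mul_pow, inv_pow, Real.sq_sqrt hn0.le]; ring
    rw [Finset.sum_congr rfl fun i _ => this i, ← Finset.mul_sum, ← hsq]
    field_simp
    ring
  -- The exponent d collects p cubic remainders of size at most 2(cρ)³ each, times n/2; the
  -- quadratic part is the trace form exactly.
  refine ⟨n / 2 * ∑ i, (Real.log (1 + x i) - x i + x i ^ 2 / 2), ?_, ?_⟩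
  · rw [abs_mul, abs_of_nonneg (by positivity)]
    calc _ ≤ (n : ℝ) / 2 * ∑ _i : Fin p, 2 * (c * ρ) ^ 3 := by
          gcongr
          refine (Finset.abs_sum_le_sum_abs _ _).trans (Finset.sum_le_sum fun i _ => ?_)
          refine (abs_log_one_add_sub_le ((hxle i).trans hρ)).trans ?_
          have := pow_le_pow_left₀ (abs_nonneg _) (hxle i) 3
          linarith
      _ = _ := by
          rw [Finset.sum_const, Finset.card_univ, Fintype.card_fin, nsmul_eq_mul]; ring
  · rw [hl, ← Real.exp_add]
    congr 1
    rw [Finset.sum_add_distrib, mul_add, hxsq]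
    ring

end Likelihood

/-! ### Measurability and normalization of the posterior. -/

section Posterior
variable {n p : ℕ} {S : Matrix (Fin p) (Fin p) ℝ} {π : Matrix (Fin p) (Fin p) ℝ → ℝ}

/-- Positive definite means semidefinite and invertible: a closed condition, so its uncountable
intersection is harmless, and an open one. -/
theorem measurableSet_posDef {E : Type*} [TopologicalSpace E] [MeasurableSpace E]
    [OpensMeasurableSpace E] {F : E → Matrix (Fin p) (Fin p) ℝ} (hF : Continuous F)
    (hs : ∀ t, (F t).IsSymm) : MeasurableSet {t | (F t).PosDef} := by
  have h : {t | (F t).PosDef} =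
      (⋂ x : Fin p → ℝ, {t | 0 ≤ x ⬝ᵥ (F t *ᵥ x)}) ∩ {t | (F t).det ≠ 0} := by
    ext t
    simp only [Set.mem_inter_iff, Set.mem_iInter]
    constructor
    · intro h
      exact ⟨fun x => by simpa using h.posSemidef.dotProduct_mulVec_nonneg x, h.det_pos.ne'⟩
    · rintro ⟨h1, h2⟩
      have h3 : (F t).PosSemidef := Matrix.PosSemidef.of_dotProduct_mulVec_nonneg
        (isHermitian_iff_isSymm.2 (hs t)) fun x => by simpa using h1 x
      exact h3.posDef_iff_isUnit.2 ((isUnit_iff_isUnit_det _).2 (isUnit_iff_ne_zero.2 h2))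
  rw [h]
  refine (IsClosed.measurableSet (isClosed_iInter fun x => ?_)).inter
    (IsOpen.measurableSet (isOpen_ne_fun hF.matrix_det continuous_const))
  exact isClosed_le continuous_const (by fun_prop)

theorem continuous_precOf : Continuous (precOf n S) := by
  have h := continuous_symMat (p := p)
  unfold precOf
  fun_prop

theorem precOf_eq_symMat (hS : S.IsSymm) (t : VechIdx p → ℝ) :
    precOf n S t = symMat (vech S⁻¹ + (√(n : ℝ))⁻¹ • t) := by
  rw [precOf, symMat_add, symMat_smul, symMat_vech (isSymm_inv hS)]

theorem measurableSet_localSet (hS : S.IsSymm) : MeasurableSet (localSet n S) :=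
  measurableSet_posDef continuous_precOf (isSymm_precOf hS)

theorem measurable_likRatio (hS : S.IsSymm) : Measurable (likRatio n S) := by
  refine Measurable.indicator ?_ (measurableSet_localSet hS)
  have hc := continuous_precOf (n := n) (S := S)
  refine Real.measurable_exp.comp (Measurable.sub_const ?_ _)
  have h1 : Measurable fun t => (precOf n S t).det := hc.matrix_det.measurable
  have h2 : Measurable fun t => (precOf n S t * S).trace :=
    (hc.matrix_mul continuous_const).matrix_trace.measurable
  unfold logLik
  exact (((Real.measurable_log.comp h1).const_mul _).const_add _).sub (h2.const_mul _)

theorem IsPriorDensity.measurable_precOf (hπ : IsPriorDensity π) (hS : S.IsSymm) :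
    Measurable fun t => π (precOf n S t) := by
  simp_rw [precOf_eq_symMat hS]
  have h : Measurable fun t : VechIdx p → ℝ => vech S⁻¹ + (√(n : ℝ))⁻¹ • t := by fun_prop
  exact hπ.measurable.comp h

/-- The map T ↦ S⁻¹ + T/√n is affine in the coordinates, so κ is a Jacobian. Only its being positive
and finite matters. -/
theorem IsPriorDensity.lintegral_precOf (hπ : IsPriorDensity π) (hS : S.IsSymm) (hn : 0 < n) :
    ∃ κ : ℝ≥0∞, κ ≠ 0 ∧ κ ≠ ∞ ∧
      ∫⁻ t in localSet n S, ENNReal.ofReal (π (precOf n S t)) = κ := by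
  have hn' : (√(n : ℝ))⁻¹ ≠ 0 := (inv_pos.2 (Real.sqrt_pos.2 (by exact_mod_cast hn))).ne'
  set r := (√(n : ℝ))⁻¹ with hr
  have hpd : MeasurableSet {t : VechIdx p → ℝ | (symMat t).PosDef} :=
    measurableSet_posDef continuous_symMat isSymm_symMat
  set g : (VechIdx p → ℝ) → ℝ≥0∞ :=
    {t : VechIdx p → ℝ | (symMat t).PosDef}.indicator fun t => ENNReal.ofReal (π (symMat t)) with hg
  have hgm : Measurable g := hπ.measurable.ennreal_ofReal.indicator hpd
  have hg1 : ∫⁻ t, g t = 1 := by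
    rw [hg, lintegral_indicator hpd, hπ.lintegral_eq_one]
  have h1 : ∫⁻ t in localSet n S, ENNReal.ofReal (π (precOf n S t)) =
      ∫⁻ t, g (vech S⁻¹ + r • t) := by
    rw [← lintegral_indicator (measurableSet_localSet hS)]
    refine lintegral_congr fun t => ?_
    have h0 : precOf n S t = symMat (vech S⁻¹ + r • t) := precOf_eq_symMat hS t
    have hiff : t ∈ localSet n S ↔
        vech S⁻¹ + r • t ∈ {t : VechIdx p → ℝ | (symMat t).PosDef} := by
      change (precOf n S t).PosDef ↔ (symMat (vech S⁻¹ + r • t)).PosDef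
      rw [h0]
    rw [hg]
    by_cases ht : t ∈ localSet n S
    · rw [Set.indicator_of_mem ht, Set.indicator_of_mem (hiff.1 ht), h0]
    · rw [Set.indicator_of_notMem ht, Set.indicator_of_notMem fun h => ht (hiff.2 h)]
  have h2 : ∫⁻ t, g (vech S⁻¹ + r • t) =
      ENNReal.ofReal |(r ^ Module.finrank ℝ (VechIdx p → ℝ))⁻¹| := by
    have h3 := lintegral_map (μ := volume) (f := fun t => g (vech S⁻¹ + t))
      (g := fun t : VechIdx p → ℝ => r • t) (hgm.comp (measurable_id.const_add _))
      (measurable_id.const_smul r)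
    rw [← h3, Measure.map_addHaar_smul _ hn', lintegral_smul_measure,
      lintegral_add_left_eq_self g, hg1, smul_eq_mul, mul_one]
  refine ⟨_, ?_, ENNReal.ofReal_ne_top, h1.trans h2⟩
  rw [ne_eq, ENNReal.ofReal_eq_zero, not_le]
  positivity

/-- The posterior density is a genuine probability density. -/
theorem IsPriorDensity.posterior (hπ : IsPriorDensity π) (hS : S.PosDef) (hn : 0 < n) :
    ∃ D : ℝ, 0 < D ∧ (∀ t, postDensity n π S t = likRatio n S t * π (precOf n S t) / D) ∧
      (∀ t, 0 ≤ postDensity n π S t) ∧ Integrable (postDensity n π S) ∧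
      ∫ t, postDensity n π S t = 1 := by
  have hsym : S.IsSymm := isHermitian_iff_isSymm.1 hS.1
  have hL := measurableSet_localSet (n := n) hsym
  obtain ⟨κ, hκ0, hκt, hκ⟩ := hπ.lintegral_precOf hsym hn
  set h : (VechIdx p → ℝ) → ℝ := fun t => likRatio n S t * π (precOf n S t) with hh
  have hout : ∀ t, t ∉ localSet n S → h t = 0 := fun t ht => by
    simp [hh, likRatio, Set.indicator_of_notMem ht]
  have hnn : ∀ t, 0 ≤ h t := by
    intro t
    by_cases ht : t ∈ localSet n S
    · exact mul_nonneg (likRatio_nonneg t) (hπ.nonneg _ ht)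
    · rw [hout t ht]
  have hm : Measurable h := (measurable_likRatio hsym).mul (hπ.measurable_precOf hsym)
  have hset : ∫⁻ t in localSet n S, ENNReal.ofReal (h t) = ∫⁻ t, ENNReal.ofReal (h t) := by
    rw [← lintegral_indicator hL]
    refine lintegral_congr fun t => ?_
    by_cases ht : t ∈ localSet n S
    · rw [Set.indicator_of_mem ht]
    · rw [Set.indicator_of_notMem ht, hout t ht, ENNReal.ofReal_zero]
  have hle : ∫⁻ t in localSet n S, ENNReal.ofReal (h t) ≤ κ := by
    rw [← hκ]
    refine setLIntegral_mono' hL fun t ht => ENNReal.ofReal_le_ofReal ?_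
    exact mul_le_of_le_one_left (hπ.nonneg _ ht) (likRatio_le_one hS t)
  have hint : Integrable h := by
    refine ⟨hm.aestronglyMeasurable, ?_⟩
    rw [hasFiniteIntegral_iff_ofReal (ae_of_all _ hnn), ← hset]
    exact hle.trans_lt (lt_top_iff_ne_top.2 hκt)
  have hDset : ∫ t in localSet n S, h t = ∫ t, h t :=
    setIntegral_eq_integral_of_forall_compl_eq_zero hout
  -- If the normalizer vanished, positivity of the likelihood ratio on `localSet` would make the
  -- prior vanish almost everywhere there, contradicting κ ≠ 0.
  have hDpos : 0 < ∫ t, h t := by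
    rw [integral_pos_iff_support_of_nonneg hnn hint]
    by_contra hz
    have hz' : volume (Function.support h) = 0 := by simpa using hz
    apply hκ0
    rw [← hκ, setLIntegral_eq_zero_iff hL (hπ.measurable_precOf hsym).ennreal_ofReal]
    have hae : ∀ᵐ t, h t = 0 := hz'
    filter_upwards [hae] with t ht htL
    have : π (precOf n S t) = 0 := by
      rcases mul_eq_zero.1 ht with h1 | h1
      · exact absurd h1 (likRatio_pos htL).ne'
      · exact h1
    rw [this, ENNReal.ofReal_zero]
  have hpost : postDensity n π S = fun t => h t / ∫ t, h t := by
    ext t; rw [postDensity, hDset]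
  refine ⟨∫ t, h t, hDpos, fun t => by rw [hpost], fun t => ?_, ?_, ?_⟩
  · rw [hpost]; exact div_nonneg (hnn t) hDpos.le
  · rw [hpost]; exact hint.div_const _
  · rw [hpost, integral_div, div_self hDpos.ne']

end Posterior

/-! ### Comparing nearly proportional densities. -/

section TotalVariation
variable {α : Type*} [MeasurableSpace α] {μ : Measure α} {F G : α → ℝ} {A : Set α}

theorem integral_compl_le_of_lintegral (hF : Integrable F μ) (hF0 : ∀ x, 0 ≤ F x) {ε : ℝ}
    (hε : 0 ≤ ε) (h : ∫⁻ x in Aᶜ, ENNReal.ofReal (F x) ∂μ ≤ ENNReal.ofReal ε) :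
    ∫ x in Aᶜ, F x ∂μ ≤ ε := by
  rw [integral_eq_lintegral_of_nonneg_ae (ae_of_all _ hF0) hF.integrableOn.aestronglyMeasurable]
  exact ENNReal.toReal_le_of_le_ofReal hε h

/-- Two probability densities that are nearly proportional on a set carrying nearly all the mass
of both are close in total variation. -/
theorem integral_abs_sub_le_of_nearly_proportional (hF : Integrable F μ) (hG : Integrable G μ)
    (hF0 : ∀ x, 0 ≤ F x) (hG0 : ∀ x, 0 ≤ G x) (hF1 : ∫ x, F x ∂μ = 1) (hG1 : ∫ x, G x ∂μ = 1)
    (hA : MeasurableSet A) {ε κ : ℝ} (hε : 0 ≤ ε) (hε1 : ε ≤ 1 / 4) (hκ : 0 ≤ κ)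
    (hFA : ∫ x in Aᶜ, F x ∂μ ≤ ε) (hGA : ∫ x in Aᶜ, G x ∂μ ≤ ε)
    (hlo : ∀ x ∈ A, (1 - ε) * κ * G x ≤ F x) (hhi : ∀ x ∈ A, F x ≤ (1 + ε) * κ * G x) :
    ∫ x, |F x - G x| ∂μ ≤ 8 * ε := by
  have hFs := integral_add_compl hA hF
  have hGs := integral_add_compl hA hG
  rw [hF1] at hFs
  rw [hG1] at hGs
  have hFc : 0 ≤ ∫ x in Aᶜ, F x ∂μ := integral_nonneg hF0
  have hGc : 0 ≤ ∫ x in Aᶜ, G x ∂μ := integral_nonneg hG0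
  have h1 : (1 - ε) * κ * ∫ x in A, G x ∂μ ≤ ∫ x in A, F x ∂μ := by
    rw [← integral_const_mul]
    exact setIntegral_mono_on (hG.integrableOn.const_mul _) hF.integrableOn hA hlo
  have h2 : ∫ x in A, F x ∂μ ≤ (1 + ε) * κ * ∫ x in A, G x ∂μ := by
    rw [← integral_const_mul]
    exact setIntegral_mono_on hF.integrableOn (hG.integrableOn.const_mul _) hA hhi
  set a := ∫ x in A, F x ∂μ
  set b := ∫ x in A, G x ∂μ
  have hb0 : 1 - ε ≤ b := by linarith
  have hb1 : b ≤ 1 := by linarith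
  have ha0 : 1 - ε ≤ a := by linarith
  have ha1 : a ≤ 1 := by linarith
  -- The masses of A lie in [1 − ε, 1], so integrating the two-sided bound over A pins the unknown
  -- constant κ near 1.
  have hk1 : (1 - ε) ^ 2 * κ ≤ 1 := by
    have : (1 - ε) * κ * (1 - ε) ≤ (1 - ε) * κ * b :=
      mul_le_mul_of_nonneg_left hb0 (mul_nonneg (by linarith) hκ)
    nlinarith
  have hk2 : 1 - ε ≤ (1 + ε) * κ := by
    have : (1 + ε) * κ * b ≤ (1 + ε) * κ * 1 :=
      mul_le_mul_of_nonneg_left hb1 (mul_nonneg (by linarith) hκ)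
    linarith
  have hu : (1 + ε) * κ ≤ 1 + 6 * ε := by
    have e1 : (1 + ε) ≤ (1 + 6 * ε) * (1 - ε) ^ 2 := by nlinarith [mul_nonneg hε hε]
    have e2 : (1 + ε) * κ ≤ (1 + 6 * ε) * ((1 - ε) ^ 2 * κ) := by
      rw [← mul_assoc]; exact mul_le_mul_of_nonneg_right e1 hκ
    nlinarith
  have hl : 1 - 6 * ε ≤ (1 - ε) * κ := by
    have e1 : (1 - 6 * ε) * (1 + ε) ≤ (1 - ε) ^ 2 := by nlinarith [mul_nonneg hε hε]
    have e2 : (1 - 6 * ε) * (1 + ε) ≤ (1 - ε) * κ * (1 + ε) := by nlinarith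
    exact le_of_mul_le_mul_right e2 (by linarith)
  -- The difference contributes at most 6ε on A and at most 2ε off A.
  have hpt : ∀ x ∈ A, |F x - G x| ≤ 6 * ε * G x := by
    intro x hx
    have p1 := hlo x hx
    have p2 := hhi x hx
    have p3 := mul_le_mul_of_nonneg_right hu (hG0 x)
    have p4 := mul_le_mul_of_nonneg_right hl (hG0 x)
    rw [abs_le]; constructor <;> linarith
  have hd : Integrable (fun x => |F x - G x|) μ := (hF.sub hG).abs
  have hA1 : ∫ x in A, |F x - G x| ∂μ ≤ 6 * ε * b := by
    rw [← integral_const_mul]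
    exact setIntegral_mono_on hd.integrableOn (hG.integrableOn.const_mul _) hA hpt
  have hA2 : ∫ x in Aᶜ, |F x - G x| ∂μ ≤ ε + ε := by
    calc _ ≤ ∫ x in Aᶜ, (F x + G x) ∂μ := by
          refine integral_mono hd.integrableOn (hF.integrableOn.add hG.integrableOn) fun x => ?_
          have := hF0 x
          have := hG0 x
          simp only [abs_le]; constructor <;> linarith
      _ = ∫ x in Aᶜ, F x ∂μ + ∫ x in Aᶜ, G x ∂μ :=
          integral_add hF.integrableOn hG.integrableOn
      _ ≤ _ := add_le_add hFA hGA
  rw [← integral_add_compl hA hd]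
  nlinarith

end TotalVariation

/-! ### The total variation bound for a fixed sample. -/

section Deterministic
variable {n p : ℕ} {S : Matrix (Fin p) (Fin p) ℝ} {π : Matrix (Fin p) (Fin p) ℝ → ℝ}

/-- Total variation bound for a fixed sample. -/
theorem lintegral_abs_postDensity_sub_smnDensity_le (hn : 0 < n) (hS : S.PosDef)
    (hπ : IsPriorDensity π) {c ρ ε : ℝ} (hc : 0 < c) (hSc : opNorm S ≤ c) (hρ0 : 0 ≤ ρ)
    (hρ : c * ρ ≤ 1 / 2) (hε : 0 < ε) (hε1 : ε ≤ 1 / 4) (hδ : n * p * (c * ρ) ^ 3 ≤ ε / 4)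
    (hflat : flatness n π S ρ ≤ ENNReal.ofReal (ε / 4))
    (hpost : ∫⁻ t in {t | √(n : ℝ) * ρ < opNorm (symMat t)},
      ENNReal.ofReal (postDensity n π S t) ≤ ENNReal.ofReal ε)
    (hgauss : ∫⁻ t in {t | √(n : ℝ) * ρ < opNorm (symMat t)},
      ENNReal.ofReal (smnDensity 0 (limitCov S) (symMat t)) ≤ ENNReal.ofReal ε) :
    ∫⁻ t, ENNReal.ofReal |postDensity n π S t - smnDensity 0 (limitCov S) (symMat t)| ≤
      ENNReal.ofReal (8 * ε) := by
  obtain ⟨D, hD, hpd, hp0, hpi, hp1⟩ := hπ.posterior hS hn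
  have hgi : Integrable fun t => smnDensity 0 (limitCov S) (symMat t) := by
    simp_rw [smnDensity_eq hS]
    exact (integrable_exp_traceForm hS).div_const _
  have hg1 : ∫ t, smnDensity 0 (limitCov S) (symMat t) = 1 := by
    simp_rw [smnDensity_eq hS]
    rw [integral_div, integral_exp_traceForm hS, div_self (limitConst_pos hS).ne']
  have hg0 := smnDensity_nonneg hS
  have hZ := limitConst_pos hS
  set A : Set (VechIdx p → ℝ) := {t | opNorm (symMat t) ≤ √(n : ℝ) * ρ} with hA
  have hAc : Aᶜ = {t | √(n : ℝ) * ρ < opNorm (symMat t)} := by ext t; simp [hA]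
  have hAm : MeasurableSet A :=
    (isClosed_le (continuous_opNorm.comp continuous_symMat) continuous_const).measurableSet
  have hflat' : ∀ t ∈ A, |π (precOf n S t) / π S⁻¹ - 1| ≤ ε / 4 := by
    intro t ht
    have hm := mem_localSet_of_opNorm_le hn hS hc hSc hρ ht
    have h1 : ENNReal.ofReal |π (precOf n S t) / π S⁻¹ - 1| ≤ flatness n π S ρ :=
      le_iSup₂ (f := fun t (_ : t ∈ {t | t ∈ localSet n S ∧ opNorm (symMat t) ≤ √(n : ℝ) * ρ}) =>
        ENNReal.ofReal |π (precOf n S t) / π S⁻¹ - 1|) t ⟨hm, ht⟩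
    exact (ENNReal.ofReal_le_ofReal_iff (by positivity)).1 (h1.trans hflat)
  have hsym0 : symMat (0 : VechIdx p → ℝ) = 0 := by
    have := symMat_smul (p := p) 0 0
    simpa using this
  have h0A : (0 : VechIdx p → ℝ) ∈ A := by
    have h0 : opNorm (0 : Matrix (Fin p) (Fin p) ℝ) = 0 := by simp [opNorm]
    change opNorm (symMat 0) ≤ _
    rw [hsym0, h0]
    positivity
  -- Flatness forces positivity: if π(S⁻¹) were 0, the quotient would be 0 by convention and the
  -- deviation would equal 1 > ε/4.
  have hπ0 : 0 < π S⁻¹ := by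
    refine lt_of_le_of_ne (hπ.nonneg _ hS.inv) fun h0 => ?_
    have := hflat' 0 h0A
    rw [← h0, div_zero, zero_sub, abs_neg, abs_one] at this
    linarith
  -- The ratio of posterior to normal density is κ = π(S⁻¹)·`limitConst S`/D times e^d q, where |d|
  -- and |q − 1| are at most ε/4.
  have hbd : ∀ t ∈ A, (1 - ε) * (π S⁻¹ * limitConst S / D) * smnDensity 0 (limitCov S) (symMat t) ≤
      postDensity n π S t ∧ postDensity n π S t ≤
        (1 + ε) * (π S⁻¹ * limitConst S / D) * smnDensity 0 (limitCov S) (symMat t) := by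
    intro t ht
    obtain ⟨d, hd, hl⟩ := exists_likRatio_eq_exp_mul hn hS hc hSc hρ ht
    have hd' : |d| ≤ ε / 4 := hd.trans hδ
    obtain ⟨hd1, hd2⟩ := abs_le.1 hd'
    obtain ⟨hr1, hr2⟩ := abs_le.1 (hflat' t ht)
    set q := π (precOf n S t) / π S⁻¹ with hq
    have hπt : π (precOf n S t) = q * π S⁻¹ := by rw [hq, div_mul_cancel₀ _ hπ0.ne']
    have e1 : postDensity n π S t = (Real.exp d * q) *
        (π S⁻¹ * limitConst S / D * smnDensity 0 (limitCov S) (symMat t)) := by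
      rw [hpd, hl, hπt, smnDensity_eq hS]
      field_simp
    have hnn : 0 ≤ π S⁻¹ * limitConst S / D * smnDensity 0 (limitCov S) (symMat t) :=
      mul_nonneg (by positivity) (hg0 t)
    have hexp1 : 1 - ε / 4 ≤ Real.exp d := by
      have := Real.add_one_le_exp d; linarith
    have hexp2 : Real.exp d ≤ 1 + ε / 2 := by
      have h1 := Real.add_one_le_exp (-d)
      rw [Real.exp_neg] at h1
      have h2 : (1 - ε / 4) * Real.exp d ≤ 1 := by
        have h3 : (1 - ε / 4) ≤ (Real.exp d)⁻¹ := by linarith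
        calc _ ≤ (Real.exp d)⁻¹ * Real.exp d := by gcongr
          _ = 1 := inv_mul_cancel₀ (Real.exp_pos d).ne'
      nlinarith [Real.exp_pos d]
    have hlow : 1 - ε ≤ Real.exp d * q := by
      have : (1 - ε / 4) * (1 - ε / 4) ≤ Real.exp d * q :=
        mul_le_mul hexp1 (by linarith) (by linarith) (Real.exp_pos d).le
      nlinarith
    have hhigh : Real.exp d * q ≤ 1 + ε := by
      have : Real.exp d * q ≤ (1 + ε / 2) * (1 + ε / 4) :=
        mul_le_mul hexp2 (by linarith) (by linarith) (by linarith)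
      nlinarith
    rw [e1, mul_assoc (1 - ε), mul_assoc (1 + ε)]
    exact ⟨mul_le_mul_of_nonneg_right hlow hnn, mul_le_mul_of_nonneg_right hhigh hnn⟩
  rw [← hAc] at hpost hgauss
  have hmain := integral_abs_sub_le_of_nearly_proportional hpi hgi hp0 hg0 hp1 hg1 hAm hε.le hε1
    (κ := π S⁻¹ * limitConst S / D) (by positivity)
    (integral_compl_le_of_lintegral hpi hp0 hε.le hpost)
    (integral_compl_le_of_lintegral hgi hg0 hε.le hgauss)
    (fun t ht => (hbd t ht).1) fun t ht => (hbd t ht).2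
  have hd : Integrable fun t =>
      |postDensity n π S t - smnDensity 0 (limitCov S) (symMat t)| := (hpi.sub hgi).abs
  rw [← ofReal_integral_eq_lintegral_ofReal hd (ae_of_all _ fun t => abs_nonneg _)]
  exact ENNReal.ofReal_le_ofReal hmain

end Deterministic

/-! ### Stability of the precision matrix. -/

section Perturbation
variable {p : ℕ} {S Sigma : Matrix (Fin p) (Fin p) ℝ} {k : ℝ}

/-- Quadratic forms move by at most (k/2)‖u‖², which leaves S ≥ k/2. The inverses are compared
through S⁻¹ − Σ⁻¹ = S⁻¹(Σ − S)Σ⁻¹. -/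
theorem WellConditioned.perturbation (hSigma : WellConditioned k Sigma) (hp : 0 < p) (hk : 0 < k)
    (hk1 : k ≤ 1) (hS : S.IsSymm) (h : opNorm (S - Sigma) ≤ k / 2) :
    S.PosDef ∧ opNorm S ≤ 2 / k ∧ opNorm S⁻¹ ≤ 2 / k ∧
      opNorm (S⁻¹ - Sigma⁻¹) ≤ 2 / k ^ 2 * opNorm (S - Sigma) := by
  have hdiff : ∀ u, |quadForm S u - quadForm Sigma u| ≤ k / 2 * ‖u‖ ^ 2 := by
    intro u
    rw [← quadForm_sub]
    exact (abs_quadForm_le _ _).trans (by gcongr)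
  have hlo : ∀ u, k / 2 * ‖u‖ ^ 2 ≤ quadForm S u := by
    intro u
    have h1 := (quadForm_bounds_of_wellConditioned hSigma u).1
    have h2 := (abs_le.1 (hdiff u)).1
    linarith
  have hpd : S.PosDef := posDef_of_le_quadForm hS (by linarith) hlo
  have hSigmaPd : Sigma.PosDef := posDef_of_le_quadForm hSigma.isSymm hk fun u =>
    (quadForm_bounds_of_wellConditioned hSigma u).1
  have hSigmaInv : opNorm Sigma⁻¹ ≤ 1 / k := opNorm_inv_le hp hSigma.isSymm hk fun u =>
    (quadForm_bounds_of_wellConditioned hSigma u).1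
  have hSinv : opNorm S⁻¹ ≤ 2 / k := by
    have := opNorm_inv_le hp hS (by linarith : 0 < k / 2) hlo
    rwa [one_div_div] at this
  refine ⟨hpd, ?_, hSinv, ?_⟩
  · refine opNorm_le_of_abs_quadForm_le hp hS fun u => ?_
    have h1 := (quadForm_bounds_of_wellConditioned hSigma u).2
    have h2 := (abs_le.1 (hdiff u)).2
    have h3 := hlo u
    have h4 : k / 2 ≤ 1 / k := by
      rw [le_div_iff₀ hk]; nlinarith
    have h5 : k / 2 * ‖u‖ ^ 2 ≤ 1 / k * ‖u‖ ^ 2 := by gcongr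
    have h6 : 2 / k * ‖u‖ ^ 2 = 1 / k * ‖u‖ ^ 2 + 1 / k * ‖u‖ ^ 2 := by ring
    have h7 : 0 ≤ k / 2 * ‖u‖ ^ 2 := by positivity
    rw [abs_of_nonneg (h7.trans h3)]
    linarith
  · have hSu : IsUnit S.det := hpd.det_pos.ne'.isUnit
    have hSigmaUnit : IsUnit Sigma.det := hSigmaPd.det_pos.ne'.isUnit
    have e : S⁻¹ - Sigma⁻¹ = S⁻¹ * (Sigma - S) * Sigma⁻¹ := by
      rw [Matrix.mul_sub, Matrix.sub_mul, Matrix.mul_assoc, mul_nonsing_inv _ hSigmaUnit, Matrix.mul_one,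
        nonsing_inv_mul _ hSu, Matrix.one_mul]
    rw [e]
    calc _ ≤ opNorm S⁻¹ * opNorm (Sigma - S) * opNorm Sigma⁻¹ :=
          (opNorm_mul_le _ _).trans (mul_le_mul_of_nonneg_right (opNorm_mul_le _ _)
            (opNorm_nonneg _))
      _ ≤ 2 / k * opNorm (Sigma - S) * (1 / k) := by
          have := opNorm_nonneg (Sigma - S)
          have := opNorm_nonneg Sigma⁻¹
          gcongr
      _ = _ := by rw [opNorm_sub_comm]; field_simp

end Perturbation

/-! ### Diagonal sequences and growth rates. -/

section Diagonal

/-- If every row property holds eventually, some index sequence tending to infinity slowly enough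
satisfies it along the diagonal. -/
theorem exists_tendsto_diagonal {R : ℕ → ℕ → Prop} (h : ∀ m, ∀ᶠ n in atTop, R m n) :
    ∃ f : ℕ → ℕ, Tendsto f atTop atTop ∧ ∀ᶠ n in atTop, R (f n) n := by
  simp only [eventually_atTop] at h
  choose N hN using h
  -- The largest m ≤ n whose threshold N m has been passed. The default value 0 is legitimate only
  -- once n ≥ N 0, hence the second filter below.
  refine ⟨fun n => Nat.findGreatest (fun m => N m ≤ n) n, ?_, ?_⟩
  · refine tendsto_atTop.2 fun m => ?_
    filter_upwards [eventually_ge_atTop m, eventually_ge_atTop (N m)] with n h1 h2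
    exact Nat.le_findGreatest h1 h2
  · filter_upwards [eventually_ge_atTop (N 0)] with n hn
    exact hN _ _ (Nat.findGreatest_spec (P := fun m => N m ≤ n) (Nat.zero_le n) hn)

theorem exists_pos_ofReal_lt {δ : ℝ≥0∞} (hδ : 0 < δ) :
    ∃ ε : ℝ, 0 < ε ∧ ε ≤ 1 / 4 ∧ ENNReal.ofReal (8 * ε) < δ := by
  obtain ⟨r, hr0, hr⟩ := ENNReal.lt_iff_exists_nnreal_btwn.1 hδ
  have hr0' : (0 : ℝ) < r := by exact_mod_cast hr0
  refine ⟨min (1 / 4) (r / 8), lt_min (by norm_num) (by positivity), min_le_left _ _, ?_⟩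
  refine lt_of_le_of_lt ?_ hr
  rw [← ENNReal.ofReal_coe_nnreal]
  exact ENNReal.ofReal_le_ofReal (by linarith [min_le_right (1 / 4) ((r : ℝ) / 8)])

/-- Divergence comes from M alone: once the bracket is negative, the factor p n ≥ 1 can only help,
so p may stay bounded. -/
theorem tendsto_exp_mul_sub_nhds_zero {p : ℕ → ℕ} (hp : ∀ n, 0 < p n) {M : ℕ → ℝ}
    (hM : Tendsto M atTop atTop) (a : ℝ) {b : ℝ} (hb : 0 < b) :
    Tendsto (fun n => 2 * Real.exp (p n * (a - b * M n))) atTop (𝓝 0) := by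
  have h1 : Tendsto (fun n => a - b * M n) atTop atBot := by
    have := tendsto_neg_atTop_atBot.comp (hM.const_mul_atTop hb)
    simpa [sub_eq_add_neg] using tendsto_const_nhds.add_atBot (f := fun _ => a) this
  have h2 : Tendsto (fun n => p n * (a - b * M n)) atTop atBot := by
    refine tendsto_atBot_mono' _ ?_ h1
    filter_upwards [h1.eventually_le_atBot 0] with n hn
    have : (1 : ℝ) ≤ p n := by exact_mod_cast hp n
    nlinarith
  simpa using (Real.tendsto_exp_atBot.comp h2).const_mul 2

theorem sqrt_mul_sqrt_div {n : ℕ} (hn : 0 < n) (x : ℝ) : √(n : ℝ) * √(x / n) = √x := by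
  have hn' : 0 < √(n : ℝ) := Real.sqrt_pos.2 (by exact_mod_cast hn)
  rw [Real.sqrt_div' _ (Nat.cast_nonneg n), mul_div_cancel₀ _ hn'.ne']

theorem mul_mul_sqrt_div_pow_three {n : ℕ} (hn : 0 < n) (p : ℕ) :
    n * p * √((p : ℝ) / n) ^ 3 = √((p : ℝ) ^ 5 / n) := by
  have hn' : (0 : ℝ) < n := by exact_mod_cast hn
  have h1 : √((p : ℝ) / n) ^ 2 = p / n := Real.sq_sqrt (by positivity)
  have h2 : (n * p * √((p : ℝ) / n) ^ 3) ^ 2 = (p : ℝ) ^ 5 / n := by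
    have : (n * p * √((p : ℝ) / n) ^ 3) ^ 2 = n ^ 2 * p ^ 2 * (√((p : ℝ) / n) ^ 2) ^ 3 := by ring
    rw [this, h1]
    field_simp
  rw [← h2, Real.sqrt_sq (by positivity)]

/-- The cubic error is a constant times √(p⁵/n), and p ≤ p⁵ gives p/n → 0. The factor 2/k is the
later bound on ‖S‖. -/
theorem eventually_growth {p : ℕ → ℕ} (hp_pos : ∀ n, 0 < p n)
    (hp : (fun n : ℕ => (p n : ℝ) ^ 5) =o[atTop] (fun n : ℕ => (n : ℝ))) {k : ℝ} (m : ℝ)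
    {e : ℝ} (he : 0 < e) :
    ∀ᶠ n in atTop, 0 < n ∧ p n ≤ n ∧ 2 / k * (m * √((p n : ℝ) / n)) ≤ 1 / 2 ∧
      n * p n * (2 / k * (m * √((p n : ℝ) / n))) ^ 3 ≤ e := by
  have hr5 : Tendsto (fun n : ℕ => (p n : ℝ) ^ 5 / n) atTop (𝓝 0) := hp.tendsto_div_nhds_zero
  have hle : ∀ n, (p n : ℝ) ≤ (p n : ℝ) ^ 5 := fun n =>
    le_self_pow₀ (by exact_mod_cast hp_pos n) (by norm_num)
  have hr1 : Tendsto (fun n : ℕ => (p n : ℝ) / n) atTop (𝓝 0) :=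
    squeeze_zero (fun n => by positivity)
      (fun n => div_le_div_of_nonneg_right (hle n) (Nat.cast_nonneg n)) hr5
  have hs1 : Tendsto (fun n : ℕ => 2 / k * (m * √((p n : ℝ) / n))) atTop (𝓝 0) := by
    have := ((Real.continuous_sqrt.tendsto 0).comp hr1).const_mul m |>.const_mul (2 / k)
    simpa using this
  have hs5 : Tendsto (fun n : ℕ => (2 / k * m) ^ 3 * √((p n : ℝ) ^ 5 / n)) atTop (𝓝 0) := by
    have := ((Real.continuous_sqrt.tendsto 0).comp hr5).const_mul ((2 / k * m) ^ 3)
    simpa using this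
  filter_upwards [eventually_gt_atTop 0, hr1.eventually_le_const one_pos,
    hs1.eventually_le_const (by norm_num : (0 : ℝ) < 1 / 2), hs5.eventually_le_const he]
    with n hn h1 h2 h3
  have hn' : (0 : ℝ) < n := by exact_mod_cast hn
  refine ⟨hn, ?_, h2, le_trans (le_of_eq ?_) h3⟩
  · rw [div_le_one hn'] at h1
    exact_mod_cast h1
  · rw [← mul_mul_sqrt_div_pow_three hn]; ring

end Diagonal

/-! ### Recentring the contraction at S⁻¹. -/

section Sample
variable {n p : ℕ} {S Sigma : Matrix (Fin p) (Fin p) ℝ} {π : Matrix (Fin p) (Fin p) ℝ → ℝ}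

/-- Contraction around `Ω₀` transfers to the local parameter. -/
theorem lintegral_postDensity_tail_le (hn : 0 < n) (hS : S.IsSymm) {ρ : ℝ}
    (h : opNorm (S⁻¹ - Sigma⁻¹) ≤ ρ / 2) :
    ∫⁻ t in {t | √(n : ℝ) * ρ < opNorm (symMat t)}, ENNReal.ofReal (postDensity n π S t) ≤
      postProb n π S {W | ρ / 2 < opNorm (W - Sigma⁻¹)} := by
  have hn' : 0 < √(n : ℝ) := Real.sqrt_pos.2 (by exact_mod_cast hn)
  have hL := measurableSet_localSet (n := n) hS
  have hB : MeasurableSet {t : VechIdx p → ℝ | √(n : ℝ) * ρ < opNorm (symMat t)} :=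
    (isOpen_lt continuous_const (continuous_opNorm.comp continuous_symMat)).measurableSet
  rw [← lintegral_inter_add_sdiff _ {t : VechIdx p → ℝ | √(n : ℝ) * ρ < opNorm (symMat t)} hL]
  have hzero : ∫⁻ t in {t : VechIdx p → ℝ | √(n : ℝ) * ρ < opNorm (symMat t)} \ localSet n S,
      ENNReal.ofReal (postDensity n π S t) = 0 := by
    refine le_antisymm ?_ bot_le
    calc _ ≤ ∫⁻ t in {t : VechIdx p → ℝ | √(n : ℝ) * ρ < opNorm (symMat t)} \ localSet n S,
          (0 : ℝ≥0∞) := by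
          refine setLIntegral_mono' (hB.diff hL) fun t ht => ?_
          rw [postDensity, likRatio, Set.indicator_of_notMem ht.2]
          simp
      _ = 0 := lintegral_zero
  rw [hzero, add_zero, postProb]
  refine lintegral_mono_set fun t ht => ⟨ht.2, ?_⟩
  have h1 : √(n : ℝ) * ρ < opNorm (symMat t) := ht.1
  have h2 : precOf n S t - S⁻¹ = (√(n : ℝ))⁻¹ • symMat t := by rw [precOf, add_sub_cancel_left]
  have h3 : ρ < opNorm (precOf n S t - S⁻¹) := by
    rw [h2, opNorm_smul, abs_inv, abs_of_pos hn', lt_inv_mul_iff₀ hn']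
    exact h1
  have h4 : opNorm (precOf n S t - S⁻¹) ≤
      opNorm (precOf n S t - Sigma⁻¹) + opNorm (S⁻¹ - Sigma⁻¹) := by
    rw [opNorm_sub_comm S⁻¹]
    refine le_trans (le_of_eq ?_) (opNorm_add_le _ _)
    congr 1; abel
  change ρ / 2 < opNorm (precOf n S t - Sigma⁻¹)
  linarith

end Sample

end BvM

end

/-! ### Assembly of the limit theorem. -/

theorem theorem2
    (p : ℕ → ℕ) (hp_pos : ∀ n, 0 < p n)
    (hp : (fun n : ℕ => (p n : ℝ) ^ 5) =o[atTop] (fun n : ℕ => (n : ℝ)))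
    (k σ₀ : ℝ) (hk : 0 < k) (hk1 : k ≤ 1) (hσ₀ : 0 < σ₀)
    {𝓧 : ℕ → Type*} [∀ n, MeasurableSpace (𝓧 n)]
    (P : ∀ n, Measure (𝓧 n)) [∀ n, IsProbabilityMeasure (P n)]
    (Y : ∀ n, Fin n → 𝓧 n → Fin (p n) → ℝ)
    (Sigma0 : ∀ n, Matrix (Fin (p n)) (Fin (p n)) ℝ)
    (hY : ∀ n, BvM.IsTrueModel (P n) (Y n) (Sigma0 n) k σ₀)
    (π : ∀ n, Matrix (Fin (p n)) (Fin (p n)) ℝ → ℝ)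
    (hπ : ∀ n, BvM.IsPriorDensity (π n))
    (hflat : BvM.PriorFlat P p Y π)
    (hcontr : BvM.PosteriorContracts P p Y π (fun n => (Sigma0 n)⁻¹)) :
    BvM.TendstoZeroInProb P (fun n ω =>
      let S : Matrix (Fin (p n)) (Fin (p n)) ℝ := BvM.sampleCov (fun i => Y n i ω)
      ∫⁻ t, ENNReal.ofReal |BvM.postDensity n (π n) S t
        - BvM.smnDensity 0 (BvM.limitCov S) (BvM.symMat t)|) := by
  intro δ hδ
  obtain ⟨ε, hε, hε1, hεδ⟩ := BvM.exists_pos_ofReal_lt hδ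
  -- One sequence M n = f n + 1 → ∞ must satisfy growth and flatness at once. The shift by 1 keeps M
  -- positive, and the probability bound 1/(m + 1) tends to 0 along it.
  obtain ⟨f, hf, hfR⟩ := BvM.exists_tendsto_diagonal (R := fun m n =>
    (0 < n ∧ p n ≤ n ∧ 2 / k * (((m : ℝ) + 1) * √((p n : ℝ) / n)) ≤ 1 / 2 ∧
      n * p n * (2 / k * (((m : ℝ) + 1) * √((p n : ℝ) / n))) ^ 3 ≤ ε / 4) ∧
    P n {ω | ENNReal.ofReal (ε / 4) ≤ BvM.flatness n (π n) (BvM.sampleCov fun i => Y n i ω)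
      (((m : ℝ) + 1) * √((p n : ℝ) / n))} ≤ ENNReal.ofReal (1 / ((m : ℝ) + 1))) fun m => by
    refine (BvM.eventually_growth hp_pos hp _ (by positivity)).and ?_
    exact (hflat ((m : ℝ) + 1) (by positivity) (ENNReal.ofReal (ε / 4))
      (ENNReal.ofReal_pos.2 (by positivity))).eventually_le_const
        (ENNReal.ofReal_pos.2 (by positivity))
  set M : ℕ → ℝ := fun n => (f n : ℝ) + 1 with hM
  have hMt : Tendsto M atTop atTop :=
    tendsto_atTop_add_const_right _ _ (tendsto_natCast_atTop_atTop.comp hf)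
  set y : ℝ := 1 / (24 * (σ₀ * (√(1 / k) * (5 / 4))) ^ 2) with hy
  have hy0 : 0 < y := by
    have := Real.sqrt_pos.2 (one_div_pos.2 hk)
    rw [hy]; positivity
  set S : ∀ n, 𝓧 n → Matrix (Fin (p n)) (Fin (p n)) ℝ :=
    fun n ω => BvM.sampleCov fun i => Y n i ω with hS
  have hbad1 : Tendsto (fun n => ENNReal.ofReal (1 / M n)) atTop (𝓝 0) := by
    have := ENNReal.tendsto_ofReal (tendsto_inv_atTop_zero.comp hMt)
    simpa using this
  -- Half of the radius is reserved for the distance from Ω₀ to S⁻¹.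
  have hbad2 := hcontr (fun n => M n / 2) (hMt.atTop_div_const (by norm_num))
    (ENNReal.ofReal ε) (ENNReal.ofReal_pos.2 hε)
  have hbad3 : Tendsto (fun n => ENNReal.ofReal
      (2 * Real.exp (p n * (10 - y * k ^ 2 / 16 * M n)))) atTop (𝓝 0) := by
    have := ENNReal.tendsto_ofReal (BvM.tendsto_exp_mul_sub_nhds_zero hp_pos hMt 10
      (by positivity : 0 < y * k ^ 2 / 16))
    simpa using this
  have hgauss : ∀ᶠ n in atTop,
      2 * Real.exp (p n * (2 + (25 / 16 * (2 / k)) ^ 2 - 1 / 4 * M n)) ≤ ε :=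
    (BvM.tendsto_exp_mul_sub_nhds_zero hp_pos hMt (2 + (25 / 16 * (2 / k)) ^ 2)
      (by norm_num : (0 : ℝ) < 1 / 4)).eventually_le_const hε
  have hlim := (hbad1.add hbad2).add hbad3
  simp only [add_zero] at hlim
  refine tendsto_of_tendsto_of_tendsto_of_le_of_le' tendsto_const_nhds hlim
    (Eventually.of_forall fun n => zero_le) ?_
  filter_upwards [hfR, hgauss] with n hR hG
  obtain ⟨⟨hn, hpn, hρ, hcub⟩, hfl⟩ := hR
  set r : ℝ := √((p n : ℝ) / n) with hr
  have hr0 : 0 ≤ r := Real.sqrt_nonneg _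
  have hM0 : 0 < M n := by simp only [hM]; positivity
  -- The factor k²/4 is set so that the perturbation constant 2/k² turns the deviation of S into M
  -- r/2 for S⁻¹.
  have hconc := (hY n).measure_le_opNorm_sub_le hk hσ₀ hn (hp_pos n) hpn hy (k ^ 2 / 4 * M n)
  -- Outside three bad events (prior not flat, posterior not concentrated, S far from Σ₀) the
  -- fixed-sample bound applies and gives at most 8ε, which is below δ.
  have hsub : {ω | δ ≤ ∫⁻ t, ENNReal.ofReal |BvM.postDensity n (π n) (S n ω) t
        - BvM.smnDensity 0 (BvM.limitCov (S n ω)) (BvM.symMat t)|} ⊆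
      ({ω | ENNReal.ofReal (ε / 4) ≤ BvM.flatness n (π n) (S n ω) (M n * r)} ∪
        {ω | ENNReal.ofReal ε ≤ BvM.postProb n (π n) (S n ω)
          {W | M n / 2 * r < BvM.opNorm (W - (Sigma0 n)⁻¹)}}) ∪
        {ω | k ^ 2 / 4 * M n * r ≤ BvM.opNorm (S n ω - Sigma0 n)} := by
    intro ω hω
    by_contra hnot
    simp only [Set.mem_union, not_or] at hnot
    obtain ⟨⟨h1, h2⟩, h3⟩ := hnot
    replace h1 : BvM.flatness n (π n) (S n ω) (M n * r) ≤ ENNReal.ofReal (ε / 4) :=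
      le_of_not_ge h1
    replace h2 : BvM.postProb n (π n) (S n ω)
        {W | M n / 2 * r < BvM.opNorm (W - (Sigma0 n)⁻¹)} ≤ ENNReal.ofReal ε := le_of_not_ge h2
    replace h3 : BvM.opNorm (S n ω - Sigma0 n) ≤ k ^ 2 / 4 * (M n * r) := by
      rw [← mul_assoc]; exact le_of_not_ge h3
    have hρk : M n * r ≤ k / 4 := by
      rw [div_mul_eq_mul_div, div_le_iff₀ hk] at hρ
      linarith
    have hρ0 : 0 ≤ M n * r := by positivity
    have hSs : (S n ω).IsSymm := BvM.isSymm_sampleCov _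
    obtain ⟨hpd, hS1, hS2, hS3⟩ := (hY n).wellConditioned.perturbation (hp_pos n) hk hk1 hSs
      (h3.trans (by nlinarith [sq_nonneg k]))
    have hinv : BvM.opNorm ((S n ω)⁻¹ - (Sigma0 n)⁻¹) ≤ M n * r / 2 := by
      refine hS3.trans ?_
      calc 2 / k ^ 2 * BvM.opNorm (S n ω - Sigma0 n) ≤ 2 / k ^ 2 * (k ^ 2 / 4 * (M n * r)) := by
            gcongr
        _ = M n * r / 2 := by field_simp; norm_num
    have htail := BvM.lintegral_postDensity_tail_le (π := π n) hn hSs hinv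
    rw [show M n * r / 2 = M n / 2 * r by ring] at htail
    have hgtail : ∫⁻ t in {t | √(n : ℝ) * (M n * r) < BvM.opNorm (BvM.symMat t)},
        ENNReal.ofReal (BvM.smnDensity 0 (BvM.limitCov (S n ω)) (BvM.symMat t)) ≤
          ENNReal.ofReal ε := by
      refine (lintegral_mono_set fun t ht => ?_).trans
        ((BvM.lintegral_smnDensity_tail_le (hp_pos n) hpd hS2 (M n)).trans
          (ENNReal.ofReal_le_ofReal (le_trans (le_of_eq ?_) hG)))
      · have ht' : √(n : ℝ) * (M n * r) < BvM.opNorm (BvM.symMat t) := ht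
        have e : √(n : ℝ) * (M n * r) = M n * √(p n : ℝ) := by
          rw [← BvM.sqrt_mul_sqrt_div hn (p n : ℝ)]; ring
        rw [e] at ht'
        exact ht'.le
      · congr 3; ring
    have hfinal := BvM.lintegral_abs_postDensity_sub_smnDensity_le hn hpd (hπ n)
      (by positivity : 0 < 2 / k) hS1 hρ0 hρ hε hε1 hcub h1 (htail.trans h2) hgtail
    exact absurd (le_trans hω hfinal) (not_le.2 hεδ)
  -- Monotonicity and subadditivity hold for the outer measure, so these events need not be
  -- measurable.
  calc _ ≤ P n _ := measure_mono hsub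
    _ ≤ _ := (measure_union_le _ _).trans (add_le_add_left (measure_union_le _ _) _)
    _ ≤ _ := by
      refine add_le_add (add_le_add hfl le_rfl) (hconc.trans (le_of_eq ?_))
      congr 4; ring
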